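/- **Theorem (Alternative Characterization of $\bar R_n$).** Let $n\ge 1$ and consider the Gaussian channel $Y=X+Z$, where $X\in\mathbb{R}^n$ is independent of $Z\sim\mathcal N(0,I_n)$. For $R\ge 0$ let $\mathcal B_0(R)=\{x\in\mathbb{R}^n:\|x\|\le R\}$ and let $X_R$ be uniformly distributed on the sphere $\{x\in\mathbb{R}^n:\|x\|=R\}$. The input $X_R$ is called optimal if it attains $$\max_{X\in\mathcal B_0(R)} I(X;Y),$$ the maximum being over all random vectors $X$ with values in $\mathcal B_0(R)$. Then the maximum $$\bar R_n:=\max\{R\ge 0: X_R\text{ is optimal}\}$$ exists, $\bar R_n>0$, and for every $R\ge 0$ the input $X_R$ is optimal if and only if $R\le\bar R_n$. Moreover, $\bar R_n$ is the unique $R>0$ that satisfies $$\mathbb{E}\left[\frac{W_1}{\|W\|}\,h_{\frac n2}\left(R\|W\|\right)\right]=\frac12 .$$ Here $h_v(x)=I_v(x)/I_{v-1}(x)$, where $I_v$ is the modified Bessel function of the first kind of order $v$, and $W=(W_1,\dots,W_n)$ is a random vector (whose law depends on $R$) with independent components, such that $W_1$ has the probability density $w\mapsto \frac{Q(w-R)-Q(w)}{R}$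 on $\mathbb{R}$, with $Q(w)=\frac{1}{\sqrt{2\pi}}\int_w^\infty e^{-t^2/2}\,dt$, and $W_i\sim\mathcal N(0,1)$ for $2\le i\le n$. -/

import Mathlib

open MeasureTheory ProbabilityTheory

noncomputable section

namespace SphereInput

/-- The modified Bessel function of the first kind of real order `v` at a real argument `x ≥ 0`:
`I_v(x) = ∑ₘ (x / 2) ^ (2 m + v) / (m! Γ(m + v + 1))`. -/
def besselI (v x : ℝ) : ℝ :=
  ∑' m : ℕ, (x / 2) ^ (2 * (m : ℝ) + v) / ((m.factorial : ℝ) * Real.Gamma ((m : ℝ) + v + 1))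

/-- The ratio `h_v(x) = I_v(x) / I_{v-1}(x)` of modified Bessel functions. -/
def besselRatio (v x : ℝ) : ℝ := besselI v x / besselI (v - 1) x

/-- The Gaussian tail function `Q(w) = P(N > w)` for `N ∼ N(0,1)`. -/
def gaussianQ (w : ℝ) : ℝ := (gaussianReal 0 1).real (Set.Ioi w)

/-- The mutual information `I(X;Y)` (in nats) of two random variables: the Kullback–Leibler
divergence of the joint law from the product of the marginal laws. -/
def mutualInformation {Ω α β : Type*} [MeasurableSpace Ω] [MeasurableSpace α] [MeasurableSpace β]
    (μ : Measure Ω) (X : Ω → α) (Y : Ω → β) : ENNReal :=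
  InformationTheory.klDiv (μ.map (fun ω => (X ω, Y ω))) ((μ.map X).prod (μ.map Y))

/-- `I(P_X) = I(X;Y)` for the channel `Y = X + Z`, where `X ∼ P` and `Z ∼ N(0, I_n)` are
independent. They are realised as the two projections of the product space. -/
def channelInformation (n : ℕ) (P : Measure (EuclideanSpace ℝ (Fin n))) : ENNReal :=
  mutualInformation (P.prod (stdGaussian (EuclideanSpace ℝ (Fin n))))
    (fun p => p.1) (fun p => p.1 + p.2)

/-- `P` is the law of an admissible input: a probability measure concentrated on the closed
ball of radius `R` centred at the origin. -/
def IsAdmissibleInput (n : ℕ) (R : ℝ) (P : Measure (EuclideanSpace ℝ (Fin n))) : Prop :=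
  IsProbabilityMeasure P ∧ ∀ᵐ x ∂P, x ∈ Metric.closedBall (0 : EuclideanSpace ℝ (Fin n)) R

/-- `P` attains the capacity `max I(X;Y)` over all inputs `X` in the ball of radius `R`. -/
def IsOptimalInput (n : ℕ) (R : ℝ) (P : Measure (EuclideanSpace ℝ (Fin n))) : Prop :=
  IsAdmissibleInput n R P ∧
    ∀ P' : Measure (EuclideanSpace ℝ (Fin n)),
      IsAdmissibleInput n R P' → channelInformation n P' ≤ channelInformation n P

/-- The uniform probability distribution on the sphere `{x : ‖x‖ = R}`: the image of the
normalised surface measure of the unit sphere under `x ↦ R x`. -/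
def sphereInput (n : ℕ) (R : ℝ) : Measure (EuclideanSpace ℝ (Fin n)) :=
  (((volume : Measure (EuclideanSpace ℝ (Fin n))).toSphere Set.univ)⁻¹ •
    (volume : Measure (EuclideanSpace ℝ (Fin n))).toSphere).map
      (fun θ : Metric.sphere (0 : EuclideanSpace ℝ (Fin n)) 1 => R • (θ : EuclideanSpace ℝ (Fin n)))

/-- The radii `R ≥ 0` for which the uniform input on the sphere of radius `R` is optimal. -/
def optimalRadii (n : ℕ) : Set ℝ := {R | 0 ≤ R ∧ IsOptimalInput n R (sphereInput n R)}

/-- `R̄_n`, the largest radius for which the uniform input on the sphere is optimal. -/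
def maxRadius (n : ℕ) : ℝ := sSup (optimalRadii n)

/-- The law on `ℝ` with density `w ↦ (Q(w - R) - Q(w)) / R`. -/
def firstCoordLaw (R : ℝ) : Measure ℝ :=
  volume.withDensity (fun w => ENNReal.ofReal ((gaussianQ (w - R) - gaussianQ w) / R))

/-- The law of the random vector `W` with independent components, where the first component has
density `w ↦ (Q(w - R) - Q(w)) / R` and all the other components are `N(0,1)`. -/
def vectorLaw (n : ℕ) [NeZero n] (R : ℝ) : Measure (EuclideanSpace ℝ (Fin n)) :=
  (Measure.pi (fun i : Fin n => if i = 0 then firstCoordLaw R else gaussianReal 0 1)).map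
    (WithLp.toLp 2)

/-- `E[(W₁ / ‖W‖) h_{n/2}(R ‖W‖)]`. -/
def sphereFunctional (n : ℕ) [NeZero n] (R : ℝ) : ℝ :=
  ∫ w, w 0 / ‖w‖ * besselRatio ((n : ℝ) / 2) (R * ‖w‖) ∂(vectorLaw n R)

end SphereInput

end

/-!
The proof works with densities relative to the standard Gaussian measure `γ` on `ℝⁿ`. By the
Cameron–Martin formula (`stdGaussian_map_const_add`) the law of `x + Z` has density
`y ↦ exp (⟪x, y⟫ - ‖x‖² / 2)`, so the output of the channel with input law `P` has the density
`outputDensity P`. For inputs in a ball all logarithms grow at most linearly, the mutual information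
is the finite number `realInformation P`. Let `i_Q = infoDensity Q` be the divergence of the output
given the input from the output law of `Q`. Gibbs' inequality gives `I(P) ≤ ∫ i_Q dP`, with an error
of second order along mixtures. Hence `Q` is optimal if and only if `i_Q ≤ I(Q)` on the ball
(`IsAdmissibleInput.isOptimalInput_of_infoDensity_le`, `IsOptimalInput.infoDensity_le`).

For the uniform law `Q` on the sphere of radius `R`, let `A(s) = ∫ exp (s θ₁) dσ(θ)` be the
moment generating function of a coordinate on the unit sphere and `h = A' / A`. Rotation invariance gives
the moments of `θ₁`, so `A` is a Bessel series and `h = I_{n/2} / I_{n/2-1}`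
(`besselRatio_eq_sphereRatio`). The output density of `Q` is a multiple of `A(R ‖y‖)`, so `i_Q` is
radial, and along a ray `g(r) = i_Q(r e₁)` has the derivative `r - R C_R(r)`, where
`C_R(r) = E[(Y₁ / ‖Y‖) h(R ‖Y‖)]` for `Y = r e₁ + Z` (`meanDrift`).

Averaging over rotations, `C_R(r) / r` is the integral of the decreasing function `s ↦ h(R s) / s`
against probability weights in `s` with monotone likelihood ratio in `r`.
It is therefore decreasing, `g'` changes sign at most once, from negative to positive, and the
maximum of `g` on `[0, R]` is attained at an end point (`infoDensity_le_max`). So `Q` is optimal if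
and only if `g(0) ≤ g(R)`. Integrating `g'` gives `g(R) - g(0) = R² (1 / 2 - F(R))`, where
`F(R) = ∫₀¹ C_R(u R) du` is the functional of the theorem, since the prescribed law of `W` is that
of `U R e₁ + Z` with `U` uniform (`vectorLaw_eq_map`, `sphereFunctional_eq`).

Finally `C_R(u R)` is also the mean of `h(R ‖Y‖) h(u R ‖Y‖)` for `Y = u R e₁ + Z`. As `h` is
strictly increasing and `‖Y‖` increases stochastically with `R`, the function `F` is strictly increasing; it
is continuous, vanishes at `0` and tends to `1`, because `h` does. It takes the value `1 / 2` at
exactly one point, which is the largest optimal radius.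

All monotonicity statements rest on one identity, the `2 × 2` case of Andréief's formula
(`integral_det_mul_det`), applied to the Gaussian measure, to the law of `θ₁`, and, for power
series, to the counting measure on `ℕ`.
-/

namespace SphereInput

open Real Filter Topology Set
open scoped Pointwise RealInnerProductSpace

/-! ### Total positivity of order two -/

section TotalPositivity

variable {α : Type*} [MeasurableSpace α] {μ : Measure α} [SFinite μ]

/-- Andréief's identity for `2 × 2` determinants. -/
theorem integral_det_mul_det {f₁ f₂ g₁ g₂ : α → ℝ}
    (h₁₁ : Integrable (fun x => f₁ x * g₁ x) μ) (h₁₂ : Integrable (fun x => f₁ x * g₂ x) μ)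
    (h₂₁ : Integrable (fun x => f₂ x * g₁ x) μ) (h₂₂ : Integrable (fun x => f₂ x * g₂ x) μ) :
    Integrable (fun p : α × α => (f₁ p.1 * f₂ p.2 - f₁ p.2 * f₂ p.1) *
      (g₁ p.1 * g₂ p.2 - g₁ p.2 * g₂ p.1)) (μ.prod μ) ∧
    ∫ p : α × α, (f₁ p.1 * f₂ p.2 - f₁ p.2 * f₂ p.1) *
      (g₁ p.1 * g₂ p.2 - g₁ p.2 * g₂ p.1) ∂(μ.prod μ) =
    2 * ((∫ x, f₁ x * g₁ x ∂μ) * (∫ x, f₂ x * g₂ x ∂μ) -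
      (∫ x, f₁ x * g₂ x ∂μ) * (∫ x, f₂ x * g₁ x ∂μ)) := by
  have e : (fun p : α × α => (f₁ p.1 * f₂ p.2 - f₁ p.2 * f₂ p.1) *
      (g₁ p.1 * g₂ p.2 - g₁ p.2 * g₂ p.1)) = fun p =>
      (((f₁ p.1 * g₁ p.1) * (f₂ p.2 * g₂ p.2) - (f₁ p.1 * g₂ p.1) * (f₂ p.2 * g₁ p.2)) -
      (f₂ p.1 * g₁ p.1) * (f₁ p.2 * g₂ p.2)) + (f₂ p.1 * g₂ p.1) * (f₁ p.2 * g₁ p.2) := by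
    funext p; ring
  have i1 := h₁₁.mul_prod h₂₂
  have i2 := h₁₂.mul_prod h₂₁
  have i3 := h₂₁.mul_prod h₁₂
  have i4 := h₂₂.mul_prod h₁₁
  rw [e]
  refine ⟨((i1.sub i2).sub i3).add i4, ?_⟩
  rw [integral_add (by exact (i1.sub i2).sub i3) i4, integral_sub (by exact i1.sub i2) i3,
    integral_sub i1 i2,
    integral_prod_mul (fun x => f₁ x * g₁ x) (fun x => f₂ x * g₂ x),
    integral_prod_mul (fun x => f₁ x * g₂ x) (fun x => f₂ x * g₁ x),
    integral_prod_mul (fun x => f₂ x * g₁ x) (fun x => f₁ x * g₂ x),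
    integral_prod_mul (fun x => f₂ x * g₂ x) (fun x => f₁ x * g₁ x)]
  ring

/-- If the two determinants always have the same sign, the determinant of the integrals is
nonnegative; for `f₂ = 1` this compares the means of `f₁` under the weights `g₁` and `g₂`. -/
theorem integral_mul_integral_le_of_det {f₁ f₂ g₁ g₂ : α → ℝ}
    (h₁₁ : Integrable (fun x => f₁ x * g₁ x) μ) (h₁₂ : Integrable (fun x => f₁ x * g₂ x) μ)
    (h₂₁ : Integrable (fun x => f₂ x * g₁ x) μ) (h₂₂ : Integrable (fun x => f₂ x * g₂ x) μ)
    (h : ∀ x y, 0 ≤ (f₁ x * f₂ y - f₁ y * f₂ x) * (g₁ x * g₂ y - g₁ y * g₂ x)) :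
    (∫ x, f₁ x * g₂ x ∂μ) * (∫ x, f₂ x * g₁ x ∂μ) ≤
      (∫ x, f₁ x * g₁ x ∂μ) * (∫ x, f₂ x * g₂ x ∂μ) := by
  have := (integral_det_mul_det h₁₁ h₁₂ h₂₁ h₂₂).2
  have h2 : 0 ≤ ∫ p : α × α, (f₁ p.1 * f₂ p.2 - f₁ p.2 * f₂ p.1) *
      (g₁ p.1 * g₂ p.2 - g₁ p.2 * g₂ p.1) ∂(μ.prod μ) := integral_nonneg fun p => h p.1 p.2
  linarith

/-- A quotient of power series is monotone when the quotients of its coefficients are. -/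
theorem tsum_mul_tsum_le_of_coeff {a b : ℕ → ℝ} {x y : ℝ} (hx : 0 ≤ x) (hxy : x ≤ y)
    (hab : ∀ j k, j ≤ k → a j * b k ≤ a k * b j)
    (hax : Summable fun k => ‖a k * x ^ k‖) (hay : Summable fun k => ‖a k * y ^ k‖)
    (hbx : Summable fun k => ‖b k * x ^ k‖) (hby : Summable fun k => ‖b k * y ^ k‖) :
    (∑' k, a k * x ^ k) * (∑' k, b k * y ^ k) ≤ (∑' k, a k * y ^ k) * (∑' k, b k * x ^ k) := by
  have key : ∀ f : ℕ → ℝ, Summable (fun k => ‖f k‖) →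
      Integrable f Measure.count ∧ ∫ k, f k ∂Measure.count = ∑' k, f k := by
    intro f hf
    have hi : Integrable f Measure.count := integrable_count_iff.2 hf
    exact ⟨hi, by simpa using integral_countable hi⟩
  rw [← (key _ hax).2, ← (key _ hay).2, ← (key _ hbx).2, ← (key _ hby).2]
  refine integral_mul_integral_le_of_det (key _ hay).1 (key _ hax).1 (key _ hby).1 (key _ hbx).1 ?_
  have pw : ∀ j k, j ≤ k → x ^ k * y ^ j ≤ x ^ j * y ^ k := by
    intro j k hjk
    obtain ⟨m, rfl⟩ := Nat.exists_eq_add_of_le hjk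
    have : x ^ m ≤ y ^ m := pow_le_pow_left₀ hx hxy m
    have h0 : 0 ≤ x ^ j * y ^ j := mul_nonneg (pow_nonneg hx _) (pow_nonneg (hx.trans hxy) _)
    rw [pow_add, pow_add]
    nlinarith [mul_le_mul_of_nonneg_left this h0]
  intro j k
  rcases le_total j k with hjk | hjk
  · exact mul_nonneg_of_nonpos_of_nonpos (by linarith [hab j k hjk]) (by linarith [pw j k hjk])
  · exact mul_nonneg (by linarith [hab k j hjk]) (by linarith [pw k j hjk])

end TotalPositivity

/-! ### The uniform law on the sphere -/

section Sphere

variable {n : ℕ}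

/-- The law of the first coordinate of a uniformly distributed point of the unit sphere. -/
noncomputable def coordLaw (n : ℕ) [NeZero n] : Measure ℝ :=
  (sphereInput n 1).map (fun θ => θ 0)

/-- The first vector of the standard basis. -/
noncomputable def firstVec (n : ℕ) [NeZero n] : EuclideanSpace ℝ (Fin n) :=
  EuclideanSpace.single 0 1

theorem sphereInput_eq_map (R : ℝ) :
    sphereInput n R = (sphereInput n 1).map (fun θ => R • θ) := by
  rw [sphereInput, sphereInput, Measure.map_map (by fun_prop) (by fun_prop)]
  congr 1
  ext θ : 1
  simp

theorem norm_eq_of_sphereInput (R : ℝ) : ∀ᵐ x ∂(sphereInput n R), ‖x‖ = |R| := by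
  rw [sphereInput, ae_map_iff (by fun_prop) (measurableSet_eq_fun (by fun_prop) (by fun_prop))]
  refine Eventually.of_forall fun θ => ?_
  rw [norm_smul, norm_eq_of_mem_sphere, mul_one, Real.norm_eq_abs]

theorem exists_isometry_map_eq {u v : EuclideanSpace ℝ (Fin n)} (h : ‖u‖ = ‖v‖) :
    ∃ T : EuclideanSpace ℝ (Fin n) ≃ₗᵢ[ℝ] EuclideanSpace ℝ (Fin n), T u = v :=
  ⟨_, Submodule.reflection_sub h⟩

variable [NeZero n]

/-- The uniform law on the unit sphere is the law of `x / ‖x‖` for `x` uniform in the unit ball. -/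
theorem sphereInput_one_apply {S : Set (EuclideanSpace ℝ (Fin n))} (hS : MeasurableSet S) :
    sphereInput n 1 S = ((volume : Measure (EuclideanSpace ℝ (Fin n))) (Metric.ball 0 1))⁻¹ *
      volume {x : EuclideanSpace ℝ (Fin n) | x ∈ Metric.ball 0 1 ∧ ‖x‖⁻¹ • x ∈ S} := by
  have hset : Ioo (0 : ℝ) 1 • ((fun x : Metric.sphere (0 : EuclideanSpace ℝ (Fin n)) 1 =>
      (x : EuclideanSpace ℝ (Fin n))) '' ((fun θ : Metric.sphere (0 : EuclideanSpace ℝ (Fin n)) 1 =>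
      (1 : ℝ) • (θ : EuclideanSpace ℝ (Fin n))) ⁻¹' S)) =
      {x : EuclideanSpace ℝ (Fin n) | x ∈ Metric.ball 0 1 ∧ ‖x‖⁻¹ • x ∈ S} \ {0} := by
    ext x
    simp only [Set.mem_smul, mem_image, mem_preimage, Subtype.exists, Set.mem_sdiff,
      Set.mem_ofPred_eq, mem_singleton_iff, mem_ball_zero_iff, mem_sphere_zero_iff_norm, one_smul]
    constructor
    · rintro ⟨t, ht, _, ⟨θ, hθ, hS, rfl⟩, rfl⟩
      have hn : ‖t • θ‖ = t := by rw [norm_smul, hθ, mul_one, Real.norm_of_nonneg ht.1.le]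
      refine ⟨⟨by rw [hn]; exact ht.2, ?_⟩, ?_⟩
      · rw [hn, smul_smul, inv_mul_cancel₀ ht.1.ne', one_smul]; exact hS
      · intro h0
        rw [h0, norm_zero] at hn
        exact ht.1.ne hn
    · rintro ⟨⟨h1, h2⟩, h0⟩
      have hp : 0 < ‖x‖ := norm_pos_iff.2 h0
      refine ⟨‖x‖, ⟨hp, h1⟩, ‖x‖⁻¹ • x, ⟨_, ?_, h2, rfl⟩, ?_⟩
      · rw [norm_smul, norm_inv, norm_norm, inv_mul_cancel₀ hp.ne']
      · rw [smul_smul, mul_inv_cancel₀ hp.ne', one_smul]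
  have hm : Measurable (fun θ : Metric.sphere (0 : EuclideanSpace ℝ (Fin n)) 1 =>
      (1 : ℝ) • (θ : EuclideanSpace ℝ (Fin n))) := by fun_prop
  rw [sphereInput, Measure.map_apply hm hS, Measure.smul_apply,
    Measure.toSphere_apply' _ (hm hS), Measure.toSphere_apply_univ, hset,
    measure_sdiff_null (measure_singleton _), smul_eq_mul]
  have hd : (Module.finrank ℝ (EuclideanSpace ℝ (Fin n)) : ENNReal) ≠ 0 := by
    simp [NeZero.ne n]
  have hd' : (Module.finrank ℝ (EuclideanSpace ℝ (Fin n)) : ENNReal) ≠ ⊤ := by simp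
  rw [ENNReal.mul_inv (Or.inl hd) (Or.inl hd'), mul_mul_mul_comm,
    ENNReal.inv_mul_cancel hd hd', one_mul]

instance : IsProbabilityMeasure (sphereInput n 1) := by
  constructor
  rw [sphereInput_one_apply .univ]
  simp only [mem_univ, and_true, ofPred_mem_eq]
  exact ENNReal.inv_mul_cancel (Metric.isOpen_ball.measure_ne_zero _ ⟨0, by simp⟩)
    measure_ball_lt_top.ne

instance (R : ℝ) : IsProbabilityMeasure (sphereInput n R) := by
  rw [sphereInput_eq_map]
  exact Measure.isProbabilityMeasure_map (by fun_prop)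

instance : IsProbabilityMeasure (coordLaw n) :=
  Measure.isProbabilityMeasure_map (by fun_prop)

theorem sphereInput_one_map (T : EuclideanSpace ℝ (Fin n) ≃ₗᵢ[ℝ] EuclideanSpace ℝ (Fin n)) :
    (sphereInput n 1).map T = sphereInput n 1 := by
  ext S hS
  rw [Measure.map_apply T.continuous.measurable hS, sphereInput_one_apply hS,
    sphereInput_one_apply (T.continuous.measurable hS)]
  congr 1
  have hm : MeasurableSet {x : EuclideanSpace ℝ (Fin n) | x ∈ Metric.ball 0 1 ∧ ‖x‖⁻¹ • x ∈ S} :=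
    measurableSet_ball.inter ((by fun_prop : Measurable fun x : EuclideanSpace ℝ (Fin n) =>
      ‖x‖⁻¹ • x) hS)
  rw [← T.measurePreserving.measure_preimage hm.nullMeasurableSet]
  congr 1
  ext x
  simp

theorem norm_firstVec : ‖firstVec n‖ = 1 := by simp [firstVec]

theorem inner_firstVec (x : EuclideanSpace ℝ (Fin n)) : ⟪x, firstVec n⟫ = x 0 := by
  simp [firstVec, EuclideanSpace.inner_single_right]

/-- By rotation invariance `⟪v, θ⟫` is distributed as `‖v‖ θ₁`. -/
theorem map_inner_sphereInput (v : EuclideanSpace ℝ (Fin n)) :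
    (sphereInput n 1).map (fun θ => ⟪v, θ⟫) = (coordLaw n).map (fun x => ‖v‖ * x) := by
  obtain ⟨T, hT⟩ := exists_isometry_map_eq (u := ‖v‖ • firstVec n) (v := v)
    (by simp [norm_smul, norm_firstVec])
  rw [coordLaw, Measure.map_map (by fun_prop) (by fun_prop)]
  conv_lhs => rw [← sphereInput_one_map T]
  rw [Measure.map_map (by fun_prop) T.continuous.measurable]
  congr 1
  ext θ
  simp only [Function.comp]
  conv_lhs => rw [← hT]
  rw [LinearIsometryEquiv.inner_map_map, real_inner_smul_left, real_inner_comm, inner_firstVec]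

theorem integral_comp_inner_sphereInput {f : ℝ → ℝ} (hf : Continuous f)
    (v : EuclideanSpace ℝ (Fin n)) :
    ∫ θ, f ⟪v, θ⟫ ∂(sphereInput n 1) = ∫ x, f (‖v‖ * x) ∂(coordLaw n) := by
  rw [← integral_map (φ := fun θ => ⟪v, θ⟫) (by fun_prop) hf.aestronglyMeasurable,
    map_inner_sphereInput, integral_map (by fun_prop) hf.aestronglyMeasurable]

theorem abs_le_one_of_coordLaw : ∀ᵐ x ∂(coordLaw n), |x| ≤ 1 := by
  rw [coordLaw, ae_map_iff (by fun_prop) (measurableSet_le (by fun_prop) (by fun_prop))]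
  filter_upwards [norm_eq_of_sphereInput (n := n) 1] with θ hθ
  rw [← inner_firstVec]
  refine (abs_real_inner_le_norm _ _).trans ?_
  rw [hθ, norm_firstVec]; simp

theorem coordLaw_map_neg : (coordLaw n).map (fun x => -x) = coordLaw n := by
  have h1 := map_inner_sphereInput (-firstVec n)
  have h2 := map_inner_sphereInput (firstVec n)
  simp only [norm_neg, norm_firstVec, one_mul, Measure.map_id'] at h1 h2
  conv_lhs => rw [← h2, Measure.map_map (by fun_prop) (by fun_prop)]
  rw [← h1]
  congr 1
  ext θ
  simp

theorem coordLaw_Ioi_pos {c : ℝ} (hc : c < 1) : 0 < coordLaw n (Ioi c) := by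
  rw [coordLaw, Measure.map_apply (by fun_prop) measurableSet_Ioi, sphereInput,
    Measure.map_apply (by fun_prop) (measurableSet_Ioi.preimage (by fun_prop)), Measure.smul_apply,
    smul_eq_mul]
  refine ENNReal.mul_pos ?_ ?_
  · simpa using (measure_lt_top (volume : Measure (EuclideanSpace ℝ (Fin n))).toSphere univ).ne
  · refine IsOpen.measure_ne_zero _ ?_ ⟨⟨firstVec n, by simp [norm_firstVec]⟩, ?_⟩
    · exact (isOpen_Ioi.preimage (by fun_prop)).preimage (by fun_prop)
    · simpa [firstVec] using hc

end Sphere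

/-! ### The moment generating function of a coordinate -/

section CoordLaw

variable {n : ℕ} [NeZero n]

theorem integrable_sphereInput {f : EuclideanSpace ℝ (Fin n) → ℝ} (hf : Continuous f) (R : ℝ) :
    Integrable f (sphereInput n R) := by
  obtain ⟨C, hC⟩ :=
    (isCompact_closedBall (0 : EuclideanSpace ℝ (Fin n)) |R|).exists_bound_of_continuousOn
      hf.continuousOn
  refine Integrable.of_bound hf.aestronglyMeasurable C ?_
  filter_upwards [norm_eq_of_sphereInput (n := n) R] with x hx
  exact hC x (by simp [hx])

theorem integrable_coordLaw {f : ℝ → ℝ} (hf : Continuous f) : Integrable f (coordLaw n) := by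
  obtain ⟨C, hC⟩ := (isCompact_closedBall (0 : ℝ) 1).exists_bound_of_continuousOn hf.continuousOn
  refine Integrable.of_bound hf.aestronglyMeasurable C ?_
  filter_upwards [abs_le_one_of_coordLaw (n := n)] with x hx
  exact hC x (by simpa using hx)

theorem integral_coordLaw_neg (f : ℝ → ℝ) :
    ∫ x, f (-x) ∂(coordLaw n) = ∫ x, f x ∂(coordLaw n) := by
  conv_rhs => rw [← coordLaw_map_neg]
  exact ((MeasurableEquiv.neg ℝ).measurableEmbedding.integral_map f).symm

/-- The even moments of a coordinate, from the coefficient of `t ^ 2` in the rotation-invariant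
moments of `θ₁ + t θⱼ`. -/
theorem integral_coordLaw_pow_succ (k : ℕ) :
    (2 * k + n : ℝ) * ∫ x, x ^ (2 * (k + 1)) ∂(coordLaw n) =
      (2 * k + 1) * ∫ x, x ^ (2 * k) ∂(coordLaw n) := by
  set m := ∫ x, x ^ (2 * (k + 1)) ∂(coordLaw n) with hm
  have hcoord : ∀ l : ℕ, ∫ x, x ^ l ∂(coordLaw n) = ∫ θ, θ 0 ^ l ∂(sphereInput n 1) := fun l =>
    integral_map (by fun_prop) (by fun_prop)
  have hj : ∀ j : Fin n, j ≠ 0 →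
      (2 * k + 1 : ℝ) * ∫ θ, θ 0 ^ (2 * k) * θ j ^ 2 ∂(sphereInput n 1) = m := by
    intro j hj
    -- Both sides of the identity below are polynomials in `t`.
    have hpoly : ∀ t : ℝ, ∫ θ, (θ 0 + t * θ j) ^ (2 * k + 2) ∂(sphereInput n 1) =
        (1 + t ^ 2) ^ (k + 1) * m := by
      intro t
      set v : EuclideanSpace ℝ (Fin n) := firstVec n + t • EuclideanSpace.single j 1 with hv
      have hin : ∀ θ : EuclideanSpace ℝ (Fin n), ⟪v, θ⟫ = θ 0 + t * θ j := by
        intro θ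
        rw [hv, inner_add_left, real_inner_smul_left, real_inner_comm, inner_firstVec]
        simp [EuclideanSpace.inner_single_left]
      have hnorm : ‖v‖ ^ 2 = 1 + t ^ 2 := by
        rw [← real_inner_self_eq_norm_sq, hin]
        simp [hv, firstVec, hj, hj.symm]
        ring
      have := integral_comp_inner_sphereInput (n := n) (f := fun x => x ^ (2 * k + 2))
        (by fun_prop) v
      simp only [hin] at this
      rw [this, hm, ← hnorm, ← pow_mul, ← integral_const_mul]
      congr 1
      ext x
      ring
    have hexp : ∀ t : ℝ, ∫ θ, (θ 0 + t * θ j) ^ (2 * k + 2) ∂(sphereInput n 1) =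
        ∑ i ∈ Finset.range (2 * k + 3), ((∫ θ, θ 0 ^ (2 * k + 2 - i) * θ j ^ i ∂(sphereInput n 1)) *
          ((2 * k + 2).choose i : ℝ)) * t ^ i := by
      intro t
      have : ∀ θ : EuclideanSpace ℝ (Fin n), (θ 0 + t * θ j) ^ (2 * k + 2) =
          ∑ i ∈ Finset.range (2 * k + 3), ((2 * k + 2).choose i : ℝ) * t ^ i *
            (θ 0 ^ (2 * k + 2 - i) * θ j ^ i) := by
        intro θ
        rw [add_comm, add_pow]
        refine Finset.sum_congr rfl fun i _ => ?_
        rw [mul_pow]; ring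
      simp_rw [this]
      rw [integral_finsetSum _ fun i _ => integrable_sphereInput (by fun_prop) 1]
      refine Finset.sum_congr rfl fun i _ => ?_
      rw [integral_const_mul]; ring
    have heq : (∑ i ∈ Finset.range (2 * k + 3), Polynomial.C
        ((∫ θ, θ 0 ^ (2 * k + 2 - i) * θ j ^ i ∂(sphereInput n 1)) * ((2 * k + 2).choose i : ℝ)) *
          Polynomial.X ^ i) =
        Polynomial.C m * Polynomial.expand ℝ 2 ((1 + Polynomial.X) ^ (k + 1)) := by
      refine Polynomial.funext fun t => ?_
      rw [Polynomial.eval_finsetSum]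
      simp only [Polynomial.eval_mul, Polynomial.eval_C, Polynomial.eval_pow, Polynomial.eval_X,
        Polynomial.expand_eval, Polynomial.eval_add, Polynomial.eval_one]
      rw [← hexp, hpoly, mul_comm]
    have hc := congrArg (fun p => Polynomial.coeff p 2) heq
    simp only [Polynomial.finsetSum_coeff, Polynomial.coeff_C_mul, Polynomial.coeff_X_pow] at hc
    rw [show (2 : ℕ) = 1 * 2 from rfl, Polynomial.coeff_expand_mul (by norm_num),
      Polynomial.coeff_one_add_X_pow] at hc
    rw [Finset.sum_eq_single 2 (fun i _ hi => by simp [hi.symm])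
      (fun h => by simp at h)] at hc
    simp only [one_mul, if_true, mul_one, Nat.choose_one_right] at hc
    have h2 : ((2 * k + 2).choose 2 : ℝ) = (k + 1) * (2 * k + 1) := by
      rw [Nat.cast_choose_two]; push_cast; ring
    rw [show 2 * k + 2 - 2 = 2 * k by omega] at hc
    norm_num at hc
    rw [h2] at hc
    have hk : (k + 1 : ℝ) ≠ 0 := by positivity
    apply mul_left_cancel₀ hk
    linarith
  have hsum : ∫ θ, θ 0 ^ (2 * k) ∂(sphereInput n 1) =
      ∑ j, ∫ θ, θ 0 ^ (2 * k) * θ j ^ 2 ∂(sphereInput n 1) := by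
    rw [← integral_finsetSum _ fun i _ => integrable_sphereInput (by fun_prop) 1]
    refine integral_congr_ae ?_
    filter_upwards [norm_eq_of_sphereInput (n := n) 1] with θ hθ
    have : ∑ j, θ j ^ 2 = 1 := by
      rw [← EuclideanSpace.real_norm_sq_eq, hθ]; simp
    rw [← Finset.mul_sum, this, mul_one]
  rw [hcoord (2 * k), hsum, Finset.mul_sum, Finset.sum_eq_add_sum_sdiff_singleton_of_mem
    (Finset.mem_univ 0)]
  rw [Finset.sum_congr rfl (g := fun _ => m) fun j hj' => hj j (by simpa using hj')]
  have h0 : ∫ θ, θ 0 ^ (2 * k) * θ 0 ^ 2 ∂(sphereInput n 1) = m := by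
    rw [hm, hcoord]
    congr 1; ext θ; ring
  rw [h0, Finset.sum_const, Finset.card_sdiff_of_subset (by simp)]
  have : 1 ≤ n := NeZero.one_le
  simp [Nat.cast_sub this]
  ring

/-- The coefficients of the even power series `s ↦ ∫ exp (s x)` of the first coordinate. -/
noncomputable def sphereCoeff (n : ℕ) [NeZero n] (k : ℕ) : ℝ :=
  (∫ x, x ^ (2 * k) ∂(coordLaw n)) / (2 * k).factorial

/-- The moment generating function `∫ exp (s θ₁) dσ(θ)` of a coordinate on the unit sphere. -/
noncomputable def sphereMGF (n : ℕ) [NeZero n] (s : ℝ) : ℝ := ∫ x, exp (s * x) ∂(coordLaw n)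

/-- The derivative `∫ θ₁ exp (s θ₁) dσ(θ)` of `sphereMGF`. -/
noncomputable def sphereMGFDeriv (n : ℕ) [NeZero n] (s : ℝ) : ℝ :=
  ∫ x, x * exp (s * x) ∂(coordLaw n)

theorem sphereCoeff_zero : sphereCoeff n 0 = 1 := by simp [sphereCoeff]

theorem sphereCoeff_succ (k : ℕ) :
    (2 * k + 2) * (2 * k + n) * sphereCoeff n (k + 1) = sphereCoeff n k := by
  have h := integral_coordLaw_pow_succ (n := n) k
  rw [sphereCoeff, sphereCoeff, show 2 * (k + 1) = 2 * k + 1 + 1 by ring, Nat.factorial_succ,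
    Nat.factorial_succ]
  rw [show 2 * (k + 1) = 2 * k + 1 + 1 by ring] at h
  have h1 : ((2 * k).factorial : ℝ) ≠ 0 := by positivity
  push_cast
  field_simp
  linear_combination 2 * (k + 1 : ℝ) * h

theorem sphereCoeff_eq (k : ℕ) :
    sphereCoeff n k = Gamma (n / 2) / (4 ^ k * k.factorial * Gamma (k + n / 2)) := by
  have hn : (0 : ℝ) < n := by exact_mod_cast Nat.pos_of_ne_zero (NeZero.ne n)
  induction k with
  | zero =>
    have := (Gamma_pos_of_pos (half_pos hn)).ne'
    simp [sphereCoeff_zero, this]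
  | succ k ih =>
    have h := sphereCoeff_succ (n := n) k
    have hp : (0 : ℝ) < k + n / 2 := by positivity
    have hG := (Gamma_pos_of_pos hp).ne'
    rw [ih] at h
    rw [show ((k + 1 : ℕ) : ℝ) + n / 2 = (k + n / 2) + 1 by push_cast; ring, Gamma_add_one hp.ne',
      Nat.factorial_succ]
    have h1 : (k.factorial : ℝ) ≠ 0 := by positivity
    have h2 : (2 * k + 2 : ℝ) * (2 * k + n) ≠ 0 := by positivity
    apply mul_left_cancel₀ h2
    rw [h]
    push_cast
    field_simp
    ring

theorem sphereCoeff_pos (k : ℕ) : 0 < sphereCoeff n k := by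
  have hn : (0 : ℝ) < n := by exact_mod_cast Nat.pos_of_ne_zero (NeZero.ne n)
  have h1 := Gamma_pos_of_pos (half_pos hn)
  have h2 : 0 < Gamma ((k : ℝ) + n / 2) := Gamma_pos_of_pos (by positivity)
  rw [sphereCoeff_eq]
  positivity

theorem hasSum_integral_coordLaw {F : ℕ → ℝ → ℝ} {f : ℝ → ℝ} {u : ℕ → ℝ}
    (hF : ∀ k, Continuous (F k)) (hu : Summable u) (hb : ∀ k x, |x| ≤ 1 → |F k x| ≤ u k)
    (hf : ∀ x, HasSum (fun k => F k x) (f x)) :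
    HasSum (fun k => ∫ x, F k x ∂(coordLaw n)) (∫ x, f x ∂(coordLaw n)) := by
  have h := hasSum_integral_of_summable_integral_norm (μ := coordLaw n) (F := F)
    (fun k => integrable_coordLaw (hF k)) ?_
  · simp_rw [fun x => (hf x).tsum_eq] at h
    exact h
  · refine Summable.of_nonneg_of_le (fun k => integral_nonneg fun x => norm_nonneg _)
      (fun k => ?_) hu
    calc ∫ x, ‖F k x‖ ∂(coordLaw n) ≤ ∫ _, u k ∂(coordLaw n) := by
          refine integral_mono_ae (integrable_coordLaw (hF k)).norm (integrable_const _) ?_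
          filter_upwards [abs_le_one_of_coordLaw (n := n)] with x hx using hb k x hx
      _ = u k := by simp

theorem hasSum_sphereMGF (s : ℝ) :
    HasSum (fun k => sphereCoeff n k * (s ^ 2) ^ k) (sphereMGF n s) := by
  have heq : sphereMGF n s = ∫ x, cosh (s * x) ∂(coordLaw n) := by
    have h := integral_coordLaw_neg (n := n) fun x => exp (s * x)
    have : ∀ x : ℝ, cosh (s * x) = (1 / 2) * exp (s * x) + (1 / 2) * exp (s * (-x)) := by
      intro x; rw [cosh_eq]; ring_nf
    simp_rw [this]
    rw [integral_add (integrable_coordLaw (by fun_prop)) (integrable_coordLaw (by fun_prop)),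
      integral_const_mul, integral_const_mul, h, sphereMGF]
    ring
  have h := hasSum_integral_coordLaw (n := n)
    (F := fun k x => (s * x) ^ (2 * k) / (2 * k).factorial)
    (f := fun x => cosh (s * x)) (fun k => by fun_prop) (Real.hasSum_cosh |s|).summable
    (fun k x hx => ?_) (fun x => Real.hasSum_cosh _)
  · rw [heq]
    rw [show (fun k => sphereCoeff n k * (s ^ 2) ^ k) =
      fun k => ∫ x, (s * x) ^ (2 * k) / (2 * k).factorial ∂(coordLaw n) from funext fun k => ?_]
    · exact h
    rw [integral_div, sphereCoeff]
    simp_rw [mul_pow]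
    rw [integral_const_mul, ← pow_mul]
    ring
  · rw [abs_div, abs_pow, abs_mul, Nat.abs_cast]
    gcongr
    exact mul_le_of_le_one_right (abs_nonneg s) hx

theorem summable_sphereCoeff (x : ℝ) : Summable fun k => ‖sphereCoeff n k * x ^ k‖ := by
  have h := (hasSum_sphereMGF (n := n) (√|x|)).summable
  rw [sq_sqrt (abs_nonneg x)] at h
  convert h using 2 with k
  rw [norm_mul, norm_pow, norm_eq_abs, norm_eq_abs, abs_of_pos (sphereCoeff_pos k)]

theorem summable_sphereCoeff_div (x : ℝ) :
    Summable fun k => ‖sphereCoeff n k / (2 * k + n) * x ^ k‖ := by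
  refine Summable.of_nonneg_of_le (fun k => norm_nonneg _) (fun k => ?_)
    (summable_sphereCoeff (n := n) x)
  have hn : (1 : ℝ) ≤ n := by exact_mod_cast NeZero.one_le
  have hk : (0 : ℝ) ≤ k := by positivity
  rw [norm_mul, norm_mul, norm_div]
  gcongr
  refine div_le_self (norm_nonneg _) ?_
  rw [norm_of_nonneg (by positivity)]
  linarith

theorem sphereMGF_eq_tsum (s : ℝ) : sphereMGF n s = ∑' k, sphereCoeff n k * (s ^ 2) ^ k :=
  (hasSum_sphereMGF s).tsum_eq.symm

theorem sphereMGFDeriv_eq_tsum (s : ℝ) :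
    sphereMGFDeriv n s = s * ∑' k : ℕ, sphereCoeff n k / (2 * k + n) * (s ^ 2) ^ k := by
  have hn : (0 : ℝ) < n := by exact_mod_cast Nat.pos_of_ne_zero (NeZero.ne n)
  have heq : sphereMGFDeriv n s = ∫ x, x * sinh (s * x) ∂(coordLaw n) := by
    have h := integral_coordLaw_neg (n := n) fun x => x * exp (s * x)
    have : ∀ x : ℝ, x * sinh (s * x) =
        (1 / 2) * (x * exp (s * x)) + (1 / 2) * ((-x) * exp (s * (-x))) := by
      intro x; rw [sinh_eq]; ring_nf
    simp_rw [this]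
    rw [integral_add (integrable_coordLaw (by fun_prop)) (integrable_coordLaw (by fun_prop)),
      integral_const_mul, integral_const_mul, h, sphereMGFDeriv]
    ring
  have h := hasSum_integral_coordLaw (n := n)
    (F := fun k x => x * ((s * x) ^ (2 * k + 1) / (2 * k + 1).factorial))
    (f := fun x => x * sinh (s * x)) (fun k => by fun_prop) (Real.hasSum_sinh |s|).summable
    (fun k x hx => ?_) (fun x => (Real.hasSum_sinh _).mul_left x)
  · rw [heq, ← h.tsum_eq, ← tsum_mul_left]
    refine tsum_congr fun k => ?_
    have hc := sphereCoeff_succ (n := n) k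
    have hd : (2 * k + n : ℝ) ≠ 0 := by positivity
    have : ∀ x : ℝ, x * ((s * x) ^ (2 * k + 1) / (2 * k + 1).factorial) =
        s ^ (2 * k + 1) / (2 * k + 1).factorial * x ^ (2 * (k + 1)) := by
      intro x; rw [mul_pow]; ring
    simp_rw [this]
    rw [integral_const_mul, ← hc, sphereCoeff, show 2 * (k + 1) = (2 * k + 1) + 1 by ring,
      Nat.factorial_succ (2 * k + 1), ← pow_mul]
    push_cast
    field_simp
    ring
  · rw [abs_mul, abs_div, abs_pow, abs_mul, Nat.abs_cast]
    refine (mul_le_of_le_one_left (by positivity) hx).trans ?_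
    gcongr
    exact mul_le_of_le_one_right (abs_nonneg s) hx

/-! ### The modified Bessel functions as integrals over the sphere -/

theorem sphereMGF_pos (s : ℝ) : 0 < sphereMGF n s :=
  integral_exp_pos (integrable_coordLaw (by fun_prop))

/-- The ratio `A' / A`, where `A` is `sphereMGF`. -/
noncomputable def sphereRatio (n : ℕ) [NeZero n] (s : ℝ) : ℝ := sphereMGFDeriv n s / sphereMGF n s

theorem besselI_eq_sphereMGF {s : ℝ} (hs : 0 < s) :
    besselI ((n : ℝ) / 2 - 1) s = (s / 2) ^ ((n : ℝ) / 2 - 1) / Gamma (n / 2) * sphereMGF n s := by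
  have hn : (0 : ℝ) < n := by exact_mod_cast Nat.pos_of_ne_zero (NeZero.ne n)
  have hG := (Gamma_pos_of_pos (half_pos hn)).ne'
  rw [sphereMGF_eq_tsum, besselI, ← tsum_mul_left]
  refine tsum_congr fun k => ?_
  have hG' := (Gamma_pos_of_pos (show (0 : ℝ) < k + n / 2 by positivity)).ne'
  rw [rpow_add (half_pos hs), sphereCoeff_eq, show (k : ℝ) + (n / 2 - 1) + 1 = k + n / 2 by ring,
    show (2 * (k : ℝ)) = ((2 * k : ℕ) : ℝ) by push_cast; ring, rpow_natCast, pow_mul, div_pow,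
    div_pow]
  norm_num
  field_simp

theorem besselI_eq_sphereMGFDeriv {s : ℝ} (hs : 0 < s) :
    besselI ((n : ℝ) / 2) s =
      (s / 2) ^ ((n : ℝ) / 2 - 1) / Gamma (n / 2) * sphereMGFDeriv n s := by
  have hn : (0 : ℝ) < n := by exact_mod_cast Nat.pos_of_ne_zero (NeZero.ne n)
  have hG := (Gamma_pos_of_pos (half_pos hn)).ne'
  rw [sphereMGFDeriv_eq_tsum, besselI, ← tsum_mul_left, ← tsum_mul_left]
  refine tsum_congr fun k => ?_
  have hp : (0 : ℝ) < k + n / 2 := by positivity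
  have hG' := (Gamma_pos_of_pos hp).ne'
  have hsp : s / 2 ≠ 0 := (half_pos hs).ne'
  rw [show (2 * (k : ℝ)) + n / 2 = ((2 * k + 1 : ℕ) : ℝ) + (n / 2 - 1) by push_cast; ring,
    rpow_add (half_pos hs), rpow_natCast, sphereCoeff_eq, Gamma_add_one hp.ne', pow_succ, pow_mul,
    div_pow, div_pow]
  norm_num
  field_simp

theorem besselRatio_eq_sphereRatio {s : ℝ} (hs : 0 ≤ s) :
    besselRatio ((n : ℝ) / 2) s = sphereRatio n s := by
  have hn : (0 : ℝ) < n := by exact_mod_cast Nat.pos_of_ne_zero (NeZero.ne n)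
  rcases hs.eq_or_lt with rfl | hs
  · have : besselI ((n : ℝ) / 2) 0 = 0 := by
      rw [besselI]
      simp only [zero_div]
      rw [tsum_congr (g := fun _ => 0) fun k => ?_, tsum_zero]
      rw [zero_rpow (by positivity), zero_div]
    rw [besselRatio, this, sphereRatio, sphereMGFDeriv_eq_tsum]
    simp
  · rw [besselRatio, sphereRatio, besselI_eq_sphereMGF hs, besselI_eq_sphereMGFDeriv hs]
    refine mul_div_mul_left _ _ (div_pos (rpow_pos_of_pos (half_pos hs) _)
      (Gamma_pos_of_pos (half_pos hn))).ne'

end CoordLaw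

/-! ### Monotonicity properties of the ratio -/

section Ratio

/-- The kernel `(p, x) ↦ ∑ c k (p x) ^ k` is totally positive of order two for nonnegative `c`. -/
theorem tsum_mul_pow_mul_le {c : ℕ → ℝ} (hc : ∀ k, 0 ≤ c k)
    (hs : ∀ x : ℝ, Summable fun k => ‖c k * x ^ k‖) {p q x y : ℝ} (hp : 0 ≤ p) (hpq : p ≤ q)
    (hx : 0 ≤ x) (hxy : x ≤ y) :
    (∑' k, c k * (q * x) ^ k) * (∑' k, c k * (p * y) ^ k) ≤
      (∑' k, c k * (q * y) ^ k) * (∑' k, c k * (p * x) ^ k) := by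
  have e : ∀ p x : ℝ, (fun k => c k * (p * x) ^ k) = fun k => (c k * p ^ k) * x ^ k := by
    intro p x; funext k; rw [mul_pow]; ring
  have hs' : ∀ p x : ℝ, Summable fun k => ‖(c k * p ^ k) * x ^ k‖ := by
    intro p x
    have := hs (p * x)
    simp_rw [mul_pow, ← mul_assoc] at this
    exact this
  simp_rw [e]
  refine tsum_mul_tsum_le_of_coeff hx hxy (fun j k hjk => ?_) (hs' _ _) (hs' _ _) (hs' _ _)
    (hs' _ _)
  obtain ⟨m, rfl⟩ := Nat.exists_eq_add_of_le hjk
  have hm : p ^ m ≤ q ^ m := pow_le_pow_left₀ hp hpq m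
  have h0 : 0 ≤ c j * c (j + m) * (q ^ j * p ^ j) :=
    mul_nonneg (mul_nonneg (hc _) (hc _))
      (mul_nonneg (pow_nonneg (hp.trans hpq) _) (pow_nonneg hp _))
  rw [pow_add, pow_add]
  nlinarith [mul_le_mul_of_nonneg_left hm h0]

variable {n : ℕ}

theorem continuous_integral_sphereInput {X : Type*} [TopologicalSpace X]
    [FirstCountableTopology X] [LocallyCompactSpace X]
    {f : X → EuclideanSpace ℝ (Fin n) → ℝ} [NeZero n]
    (hf : Continuous (Function.uncurry f)) (R : ℝ) :
    Continuous fun x => ∫ θ, f x θ ∂(sphereInput n R) := by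
  have h : sphereInput n R = (sphereInput n R).restrict (Metric.closedBall 0 |R|) := by
    refine (Measure.restrict_eq_self_of_ae_mem ?_).symm
    filter_upwards [norm_eq_of_sphereInput (n := n) R] with x hx
    simp [hx]
  rw [h]
  exact continuous_parametric_integral_of_continuous hf (isCompact_closedBall _ _)

variable [NeZero n]

theorem continuous_integral_coordLaw {X : Type*} [TopologicalSpace X]
    [FirstCountableTopology X] [LocallyCompactSpace X] {f : X → ℝ → ℝ}
    (hf : Continuous (Function.uncurry f)) : Continuous fun x => ∫ θ, f x θ ∂(coordLaw n) := by
  have h : coordLaw n = (coordLaw n).restrict (Metric.closedBall 0 1) := by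
    refine (Measure.restrict_eq_self_of_ae_mem ?_).symm
    filter_upwards [abs_le_one_of_coordLaw (n := n)] with x hx
    simpa using hx
  rw [h]
  exact continuous_parametric_integral_of_continuous hf (isCompact_closedBall _ _)

theorem continuous_sphereMGF : Continuous (sphereMGF n) :=
  continuous_integral_coordLaw (f := fun s x => exp (s * x)) (by fun_prop)

theorem continuous_sphereMGFDeriv : Continuous (sphereMGFDeriv n) :=
  continuous_integral_coordLaw (f := fun s x => x * exp (s * x)) (by fun_prop)

theorem continuous_sphereRatio : Continuous (sphereRatio n) :=
  continuous_sphereMGFDeriv.div₀ continuous_sphereMGF fun s => (sphereMGF_pos s).ne'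

theorem abs_sphereMGFDeriv_le (s : ℝ) : |sphereMGFDeriv n s| ≤ sphereMGF n s := by
  refine (abs_integral_le_integral_abs).trans ?_
  refine integral_mono_ae (integrable_coordLaw (by fun_prop)) (integrable_coordLaw (by fun_prop)) ?_
  filter_upwards [abs_le_one_of_coordLaw (n := n)] with x hx
  rw [abs_mul, abs_exp]
  exact mul_le_of_le_one_left (exp_pos _).le hx

theorem abs_sphereRatio_le (s : ℝ) : |sphereRatio n s| ≤ 1 := by
  rw [sphereRatio, abs_div, abs_of_pos (sphereMGF_pos s), div_le_one (sphereMGF_pos s)]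
  exact abs_sphereMGFDeriv_le s

theorem sphereMGF_le (s : ℝ) : sphereMGF n s ≤ exp |s| := by
  calc sphereMGF n s ≤ ∫ _, exp |s| ∂(coordLaw n) := by
        refine integral_mono_ae (integrable_coordLaw (by fun_prop)) (integrable_const _) ?_
        filter_upwards [abs_le_one_of_coordLaw (n := n)] with x hx
        refine exp_le_exp.2 ((le_abs_self _).trans ?_)
        rw [abs_mul]
        exact mul_le_of_le_one_right (abs_nonneg _) hx
    _ = exp |s| := by simp

theorem one_le_sphereMGF (s : ℝ) : 1 ≤ sphereMGF n s := by
  have h := (hasSum_sphereMGF (n := n) s).summable.le_tsum 0 fun k _ =>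
    mul_nonneg (sphereCoeff_pos k).le (by positivity)
  rw [← sphereMGF_eq_tsum, sphereCoeff_zero] at h
  simpa using h

theorem sphereMGFDeriv_zero : sphereMGFDeriv n 0 = 0 := by simp [sphereMGFDeriv_eq_tsum]

theorem sphereMGFDeriv_pos {s : ℝ} (hs : 0 < s) : 0 < sphereMGFDeriv n s := by
  rw [sphereMGFDeriv_eq_tsum]
  have hn : (0 : ℝ) < n := by exact_mod_cast Nat.pos_of_ne_zero (NeZero.ne n)
  have h0 : ∀ k : ℕ, 0 < sphereCoeff n k / (2 * k + n) * (s ^ 2) ^ k := fun k => by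
    have := sphereCoeff_pos (n := n) k
    positivity
  exact mul_pos hs ((summable_sphereCoeff_div (n := n) (s ^ 2)).of_norm.tsum_pos
    (fun k => (h0 k).le) 0 (h0 0))

theorem sphereRatio_zero : sphereRatio n 0 = 0 := by simp [sphereRatio, sphereMGFDeriv_zero]

theorem sphereRatio_pos {s : ℝ} (hs : 0 < s) : 0 < sphereRatio n s :=
  div_pos (sphereMGFDeriv_pos hs) (sphereMGF_pos s)

theorem sphereRatio_nonneg {s : ℝ} (hs : 0 ≤ s) : 0 ≤ sphereRatio n s := by
  rcases hs.eq_or_lt with rfl | hs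
  · rw [sphereRatio_zero]
  · exact (sphereRatio_pos hs).le

theorem sphereMGF_mul_le {r r' s t : ℝ} (hr : 0 ≤ r) (hrr : r ≤ r') (hs : 0 ≤ s) (hst : s ≤ t) :
    sphereMGF n (r' * s) * sphereMGF n (r * t) ≤ sphereMGF n (r' * t) * sphereMGF n (r * s) := by
  have h := tsum_mul_pow_mul_le (c := sphereCoeff n) (fun k => (sphereCoeff_pos k).le)
    summable_sphereCoeff (sq_nonneg r) (pow_le_pow_left₀ hr hrr 2) (sq_nonneg s)
    (pow_le_pow_left₀ hs hst 2)
  simp_rw [← mul_pow _ _ 2] at h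
  simpa only [sphereMGF_eq_tsum] using h

theorem sphereMGFDeriv_mul_le {r r' s t : ℝ} (hr : 0 ≤ r) (hrr : r ≤ r') (hs : 0 ≤ s)
    (hst : s ≤ t) :
    sphereMGFDeriv n (r' * s) * sphereMGFDeriv n (r * t) ≤
      sphereMGFDeriv n (r' * t) * sphereMGFDeriv n (r * s) := by
  have hn : (0 : ℝ) < n := by exact_mod_cast Nat.pos_of_ne_zero (NeZero.ne n)
  have h := tsum_mul_pow_mul_le (c := fun k => sphereCoeff n k / (2 * k + n))
    (fun k => (div_pos (sphereCoeff_pos k) (by positivity)).le) summable_sphereCoeff_div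
    (sq_nonneg r) (pow_le_pow_left₀ hr hrr 2) (sq_nonneg s) (pow_le_pow_left₀ hs hst 2)
  simp_rw [← mul_pow _ _ 2] at h
  simp_rw [sphereMGFDeriv_eq_tsum]
  have h0 : 0 ≤ r * r' * s * t := by
    have := hr.trans hrr
    have := hs.trans hst
    positivity
  calc _ = (r * r' * s * t) * _ := by ring
    _ ≤ (r * r' * s * t) * _ := mul_le_mul_of_nonneg_left h h0
    _ = _ := by ring

/-- The function `s ↦ h(s) / s` is decreasing: the quotients of the coefficients of `s ↦ A'(s) / s`
and `A` are `1 / (2 k + n)`. -/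
theorem sphereRatio_div_le {s t : ℝ} (hs : 0 < s) (hst : s ≤ t) :
    sphereRatio n t / t ≤ sphereRatio n s / s := by
  have hn : (0 : ℝ) < n := by exact_mod_cast Nat.pos_of_ne_zero (NeZero.ne n)
  have ht := hs.trans_le hst
  have h := tsum_mul_tsum_le_of_coeff (a := sphereCoeff n)
    (b := fun k => sphereCoeff n k / (2 * k + n)) (sq_nonneg s) (pow_le_pow_left₀ hs.le hst 2)
    (fun j k hjk => ?_) (summable_sphereCoeff _) (summable_sphereCoeff _)
    (summable_sphereCoeff_div _) (summable_sphereCoeff_div _)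
  · have e : ∀ s : ℝ, 0 < s → sphereRatio n s / s =
        (∑' k : ℕ, sphereCoeff n k / (2 * k + n) * (s ^ 2) ^ k) / sphereMGF n s := by
      intro s hs
      rw [sphereRatio, sphereMGFDeriv_eq_tsum]
      have := (sphereMGF_pos (n := n) s).ne'
      field_simp
    rw [e s hs, e t ht, div_le_div_iff₀ (sphereMGF_pos t) (sphereMGF_pos s), sphereMGF_eq_tsum,
      sphereMGF_eq_tsum]
    linarith
  · have hj := (sphereCoeff_pos (n := n) j).le
    have hk := (sphereCoeff_pos (n := n) k).le
    have hjk' : (j : ℝ) ≤ k := by exact_mod_cast hjk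
    rw [mul_div_assoc', mul_div_assoc', mul_comm (sphereCoeff n k)]
    gcongr

theorem sphereRatio_strictMono : StrictMono (sphereRatio n) := by
  intro s t hst
  have i : ∀ f : ℝ → ℝ, Continuous f → Integrable f (coordLaw n) := fun f hf =>
    integrable_coordLaw hf
  obtain ⟨hint, heq⟩ := integral_det_mul_det (μ := coordLaw n) (f₁ := fun x => x)
    (f₂ := fun _ => 1) (g₁ := fun x => exp (t * x)) (g₂ := fun x => exp (s * x))
    (i _ (by fun_prop)) (i _ (by fun_prop)) (i _ (by fun_prop)) (i _ (by fun_prop))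
  simp only [mul_one, one_mul] at heq hint
  have hnn : ∀ p : ℝ × ℝ, 0 ≤ (p.1 - p.2) *
      (exp (t * p.1) * exp (s * p.2) - exp (t * p.2) * exp (s * p.1)) ∧
      ((p.1 - p.2) * (exp (t * p.1) * exp (s * p.2) - exp (t * p.2) * exp (s * p.1)) = 0 →
        p.1 = p.2) := by
    rintro ⟨x, y⟩
    simp only [← exp_add]
    rcases lt_trichotomy x y with h | h | h
    · have : exp (t * x + s * y) < exp (t * y + s * x) := exp_lt_exp.2 (by nlinarith)
      have := mul_pos_of_neg_of_neg (sub_neg.2 h) (sub_neg.2 this)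
      exact ⟨this.le, fun h0 => absurd h0 this.ne'⟩
    · simp [h]
    · have : exp (t * y + s * x) < exp (t * x + s * y) := exp_lt_exp.2 (by nlinarith)
      have := mul_pos (sub_pos.2 h) (sub_pos.2 this)
      exact ⟨this.le, fun h0 => absurd h0 this.ne'⟩
  have hpos : 0 < ∫ p : ℝ × ℝ, (p.1 - p.2) *
      (exp (t * p.1) * exp (s * p.2) - exp (t * p.2) * exp (s * p.1))
      ∂((coordLaw n).prod (coordLaw n)) := by
    refine (integral_nonneg fun p => (hnn p).1).lt_of_ne' fun h0 => ?_
    -- Otherwise the coordinate would be almost surely constant, hence `0` by symmetry.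
    have hae := (integral_eq_zero_iff_of_nonneg (fun p => (hnn p).1) hint).1 h0
    have h1 : ∫ p : ℝ × ℝ, (p.1 * 1 - p.2 * 1) * (p.1 * 1 - p.2 * 1)
        ∂((coordLaw n).prod (coordLaw n)) = 0 := by
      rw [integral_congr_ae (g := fun _ => (0 : ℝ)), integral_zero]
      filter_upwards [hae] with p hp
      rw [(hnn p).2 hp]; simp
    have h2 := (integral_det_mul_det (μ := coordLaw n) (f₁ := fun x => x) (f₂ := fun _ => 1)
      (g₁ := fun x => x) (g₂ := fun _ => 1) (i _ (by fun_prop)) (i _ (by fun_prop))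
      (i _ (by fun_prop)) (i _ (by fun_prop))).2
    rw [h1] at h2
    have h3 : ∫ x, x ∂(coordLaw n) = 0 := by
      simpa [sphereMGFDeriv] using sphereMGFDeriv_zero (n := n)
    have h4 := sphereCoeff_pos (n := n) 1
    rw [sphereCoeff] at h4
    have h5 : 0 < ∫ x, x ^ 2 ∂(coordLaw n) := by
      by_contra hle
      exact absurd h4 (not_lt.2
        (div_nonpos_of_nonpos_of_nonneg (by simpa using hle) (by positivity)))
    simp only [mul_one, one_mul, h3, ← pow_two] at h2
    simp at h2
    linarith
  rw [heq] at hpos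
  rw [sphereRatio, sphereRatio, div_lt_div_iff₀ (sphereMGF_pos s) (sphereMGF_pos t)]
  simp only [sphereMGF, sphereMGFDeriv]
  linarith

theorem tendsto_sphereRatio : Tendsto (sphereRatio n) atTop (𝓝 1) := by
  rw [Metric.tendsto_atTop]
  intro ε hε
  set c := 1 - ε / 4 with hc
  set p := (coordLaw n).real (Ioi c) with hp
  have hp0 : 0 < p := by
    rw [hp, measureReal_def]
    exact ENNReal.toReal_pos (coordLaw_Ioi_pos (by rw [hc]; linarith)).ne' (measure_ne_top _ _)
  have hlow : ∀ s, 0 ≤ s → p * exp (s * c) ≤ sphereMGF n s := by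
    intro s hs
    have h1 : ∫ x, (Ioi c).indicator (fun _ => exp (s * c)) x ∂(coordLaw n) = p * exp (s * c) := by
      rw [integral_indicator_const _ measurableSet_Ioi, smul_eq_mul]
    rw [← h1]
    refine integral_mono ((integrable_const _).indicator measurableSet_Ioi)
      (integrable_coordLaw (by fun_prop)) fun x => ?_
    by_cases hx : x ∈ Ioi c
    · simp only [indicator_of_mem hx]
      exact exp_le_exp.2 (mul_le_mul_of_nonneg_left (le_of_lt hx) hs)
    · simp only [indicator_of_notMem hx]
      exact (exp_pos _).le
  -- The part of the integral below level `1 - ε / 2` is exponentially smaller than `A`.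
  have hup : ∀ s, 0 ≤ s →
      sphereMGF n s - sphereMGFDeriv n s ≤ ε / 2 * sphereMGF n s + 2 * exp (s * (1 - ε / 2)) := by
    intro s hs
    have e1 : sphereMGF n s - sphereMGFDeriv n s = ∫ x, (1 - x) * exp (s * x) ∂(coordLaw n) := by
      rw [sphereMGF, sphereMGFDeriv, ← integral_sub (integrable_coordLaw (by fun_prop))
        (integrable_coordLaw (by fun_prop))]
      congr 1; ext x; ring
    have e2 : ε / 2 * sphereMGF n s + 2 * exp (s * (1 - ε / 2)) =
        ∫ x, (ε / 2 * exp (s * x) + 2 * exp (s * (1 - ε / 2))) ∂(coordLaw n) := by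
      rw [integral_add (integrable_coordLaw (by fun_prop)) (integrable_const _),
        integral_const_mul, integral_const]
      simp [sphereMGF]
    rw [e1, e2]
    refine integral_mono_ae (integrable_coordLaw (by fun_prop))
      (integrable_coordLaw (by fun_prop)) ?_
    filter_upwards [abs_le_one_of_coordLaw (n := n)] with x hx
    have hx' := abs_le.1 hx
    rcases le_total x (1 - ε / 2) with h | h
    · have : exp (s * x) ≤ exp (s * (1 - ε / 2)) := exp_le_exp.2 (mul_le_mul_of_nonneg_left h hs)
      have h0 := exp_pos (s * x)
      nlinarith [mul_pos (half_pos hε) h0]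
    · have h0 := exp_pos (s * x)
      have h1 := exp_pos (s * (1 - ε / 2))
      nlinarith
  have hlim : Tendsto (fun s => 2 / p * exp (-(s * (ε / 4)))) atTop (𝓝 (2 / p * 0)) := by
    refine Tendsto.const_mul _ (tendsto_exp_atBot.comp (tendsto_neg_atTop_atBot.comp ?_))
    exact tendsto_id.atTop_mul_const (by positivity)
  rw [mul_zero] at hlim
  obtain ⟨S, hS⟩ := eventually_atTop.1 (hlim.eventually_lt_const (half_pos hε))
  refine ⟨max S 0, fun s hs => ?_⟩
  have hs0 : 0 ≤ s := (le_max_right _ _).trans hs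
  have h1 := hS s ((le_max_left _ _).trans hs)
  have hA := sphereMGF_pos (n := n) s
  have h2 := hup s hs0
  have h3 := hlow s hs0
  have h4 : 2 * exp (s * (1 - ε / 2)) < ε / 2 * sphereMGF n s := by
    have : exp (s * (1 - ε / 2)) = exp (-(s * (ε / 4))) * exp (s * c) := by
      rw [← exp_add, hc]; ring_nf
    rw [this]
    have h5 : 2 * exp (-(s * (ε / 4))) < ε / 2 * p := by
      rw [div_mul_eq_mul_div, div_lt_iff₀ hp0] at h1
      exact h1
    nlinarith [exp_pos (s * c)]
  have h6 : 1 - sphereRatio n s < ε := by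
    rw [sphereRatio, one_sub_div hA.ne', div_lt_iff₀ hA]
    linarith
  have h7 := (abs_le.1 (abs_sphereRatio_le (n := n) s)).2
  rw [Real.dist_eq, abs_sub_comm, abs_of_nonneg (by linarith)]
  exact h6

end Ratio

/-! ### Gaussian measures -/

section Gaussian

theorem pi_withDensity {ι : Type*} [Fintype ι] {μ : ι → Measure ℝ}
    [∀ i, IsProbabilityMeasure (μ i)] {ρ : ι → ℝ → ENNReal} (hρ : ∀ i, Measurable (ρ i))
    [∀ i, SigmaFinite ((μ i).withDensity (ρ i))] :
    Measure.pi (fun i => (μ i).withDensity (ρ i)) =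
      (Measure.pi μ).withDensity (fun y => ∏ i, ρ i (y i)) := by
  refine Measure.pi_eq fun s hs => ?_
  have hms : MeasurableSet (univ.pi s) := MeasurableSet.univ_pi hs
  rw [withDensity_apply _ hms, ← lintegral_indicator hms]
  have e : (univ.pi s).indicator (fun y : ι → ℝ => ∏ i, ρ i (y i)) =
      fun y => ∏ i, (s i).indicator (ρ i) (y i) := by
    funext y
    by_cases hy : y ∈ univ.pi s
    · rw [indicator_of_mem hy]
      exact Finset.prod_congr rfl fun i _ => (indicator_of_mem (hy i (mem_univ i)) _).symm
    · rw [indicator_of_notMem hy]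
      obtain ⟨i, hi⟩ : ∃ i, y i ∉ s i := by simpa [mem_univ_pi] using hy
      exact (Finset.prod_eq_zero (Finset.mem_univ i) (indicator_of_notMem hi _)).symm
  rw [e]
  have hmi : ∀ i, Measurable ((s i).indicator (ρ i)) := fun i => (hρ i).indicator (hs i)
  have hind := iIndepFun_pi (μ := μ) (X := fun i => (s i).indicator (ρ i))
    fun i => (hmi i).aemeasurable
  rw [lintegral_prod_eq_prod_lintegral_of_indepFun Finset.univ
    (fun i (y : ι → ℝ) => (s i).indicator (ρ i) (y i)) hind
    (fun i => (hmi i).comp (measurable_pi_apply i))]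
  refine Finset.prod_congr rfl fun i _ => ?_
  rw [withDensity_apply _ (hs i), ← lintegral_indicator (hs i)]
  exact (measurePreserving_eval μ i).lintegral_comp (hmi i)

theorem gaussianReal_eq_withDensity (x : ℝ) :
    gaussianReal x 1 =
      (gaussianReal 0 1).withDensity fun y => ENNReal.ofReal (exp (x * y - x ^ 2 / 2)) := by
  rw [gaussianReal_of_var_ne_zero x one_ne_zero, gaussianReal_of_var_ne_zero 0 one_ne_zero,
    ← withDensity_mul _ (measurable_gaussianPDF _ _) (by fun_prop)]
  congr 1
  funext y
  rw [Pi.mul_apply, gaussianPDF, gaussianPDF, ← ENNReal.ofReal_mul (gaussianPDFReal_nonneg _ _ _),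
    gaussianPDFReal, gaussianPDFReal, mul_assoc _ (exp _) (exp _), ← exp_add]
  congr 3
  simp
  ring

variable {n : ℕ}

/-- A translate of the standard Gaussian measure has an exponential density with respect to it. -/
theorem stdGaussian_map_const_add (x : EuclideanSpace ℝ (Fin n)) :
    (stdGaussian (EuclideanSpace ℝ (Fin n))).map (fun z => x + z) =
      (stdGaussian (EuclideanSpace ℝ (Fin n))).withDensity
        fun y => ENNReal.ofReal (exp (⟪x, y⟫ - ‖x‖ ^ 2 / 2)) := by
  have h1 : (Measure.pi fun _ : Fin n => gaussianReal 0 1).map (fun z i => x i + z i) =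
      (Measure.pi fun _ : Fin n => gaussianReal 0 1).withDensity
        fun y => ENNReal.ofReal (exp (⟪x, WithLp.toLp 2 y⟫ - ‖x‖ ^ 2 / 2)) := by
    rw [Measure.pi_map_pi (f := fun i z => x i + z) fun i => by fun_prop]
    have h2 : ∀ i, (gaussianReal 0 1).map (fun z => x i + z) = (gaussianReal 0 1).withDensity
        fun y => ENNReal.ofReal (exp (x i * y - x i ^ 2 / 2)) := by
      intro i
      rw [gaussianReal_map_const_add, zero_add, gaussianReal_eq_withDensity]
    have : ∀ i, SigmaFinite ((gaussianReal 0 1).withDensity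
        fun y => ENNReal.ofReal (exp (x i * y - x i ^ 2 / 2))) := by
      intro i
      rw [← gaussianReal_eq_withDensity]
      infer_instance
    simp_rw [h2]
    rw [pi_withDensity fun i => by fun_prop]
    congr 1
    funext y
    rw [← ENNReal.ofReal_prod_of_nonneg fun i _ => (exp_pos _).le, ← exp_sum,
      Finset.sum_sub_distrib, EuclideanSpace.real_norm_sq_eq, Finset.sum_div]
    congr 3
    simp [PiLp.inner_apply, mul_comm]
  rw [← map_pi_eq_stdGaussian, Measure.map_map (by fun_prop) (by fun_prop)]
  have h3 : (fun z => x + z) ∘ (WithLp.toLp 2 : (Fin n → ℝ) → EuclideanSpace ℝ (Fin n)) =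
      (WithLp.toLp 2) ∘ (fun z i => x i + z i) := by
    funext z; ext i; simp
  rw [h3, ← Measure.map_map (by fun_prop) (by fun_prop), h1]
  ext S hS
  rw [Measure.map_apply (by fun_prop) hS, withDensity_apply _ hS,
    withDensity_apply _ (hS.preimage (by fun_prop)),
    setLIntegral_map hS (by fun_prop) (by fun_prop)]

theorem integral_const_add_stdGaussian (x : EuclideanSpace ℝ (Fin n))
    {f : EuclideanSpace ℝ (Fin n) → ℝ} (hf : Measurable f) :
    ∫ z, f (x + z) ∂(stdGaussian (EuclideanSpace ℝ (Fin n))) =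
      ∫ y, exp (⟪x, y⟫ - ‖x‖ ^ 2 / 2) * f y ∂(stdGaussian (EuclideanSpace ℝ (Fin n))) := by
  rw [← integral_map (φ := fun z => x + z) (by fun_prop) hf.aestronglyMeasurable,
    stdGaussian_map_const_add, integral_withDensity_eq_integral_toReal_smul (by fun_prop)
    (by simp)]
  congr 1
  ext y
  rw [ENNReal.toReal_ofReal (exp_pos _).le, smul_eq_mul]

theorem integrable_exp_norm_stdGaussian (c : ℝ) :
    Integrable (fun z => exp (c * ‖z‖)) (stdGaussian (EuclideanSpace ℝ (Fin n))) := by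
  obtain ⟨C, hC, hint⟩ := IsGaussian.exists_integrable_exp_sq
    (stdGaussian (EuclideanSpace ℝ (Fin n)))
  refine (hint.const_mul (exp (c ^ 2 / (4 * C)))).mono' (by fun_prop) ?_
  refine Eventually.of_forall fun z => ?_
  rw [norm_of_nonneg (exp_pos _).le, ← exp_add, exp_le_exp, ← sub_nonneg]
  have : c ^ 2 / (4 * C) + C * ‖z‖ ^ 2 - c * ‖z‖ = C * (‖z‖ - c / (2 * C)) ^ 2 := by
    field_simp; ring
  rw [this]
  positivity

theorem integral_isometry_stdGaussian
    (T : EuclideanSpace ℝ (Fin n) ≃ₗᵢ[ℝ] EuclideanSpace ℝ (Fin n))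
    (f : EuclideanSpace ℝ (Fin n) → ℝ) :
    ∫ z, f (T z) ∂(stdGaussian (EuclideanSpace ℝ (Fin n))) =
      ∫ z, f z ∂(stdGaussian (EuclideanSpace ℝ (Fin n))) := by
  conv_rhs => rw [← stdGaussian_map T]
  exact (T.toHomeomorph.measurableEmbedding.integral_map f).symm

theorem integral_inner_stdGaussian (x : EuclideanSpace ℝ (Fin n)) :
    ∫ z, ⟪x, z⟫ ∂(stdGaussian (EuclideanSpace ℝ (Fin n))) = 0 :=
  integral_strongDual_stdGaussian (innerSL ℝ x)

variable [NeZero n]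

theorem stdGaussian_compl_zero_ne :
    stdGaussian (EuclideanSpace ℝ (Fin n)) {0}ᶜ ≠ 0 := by
  intro h
  have hae : ∀ᵐ z ∂(stdGaussian (EuclideanSpace ℝ (Fin n))), z = 0 := h
  have h1 := integral_const_add_stdGaussian (firstVec n)
    (f := fun _ => 1) measurable_const
  have h2 : ∫ y, exp (⟪firstVec n, y⟫ - ‖firstVec n‖ ^ 2 / 2) * 1
      ∂(stdGaussian (EuclideanSpace ℝ (Fin n))) =
      ∫ _, exp (-(1 / 2)) ∂(stdGaussian (EuclideanSpace ℝ (Fin n))) := by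
    refine integral_congr_ae ?_
    filter_upwards [hae] with z hz
    simp [hz, norm_firstVec]
  rw [h2] at h1
  have h3 : exp (-2⁻¹) < 1 := Real.exp_lt_one_iff.2 (by norm_num)
  simp at h1
  linarith

/-- Averaging over rotations: under the standard Gaussian measure, a function of one coordinate may
be replaced by its mean over the sphere of the same radius. -/
theorem integral_norm_mul_coord {φ f : ℝ → ℝ} (hφ : Measurable φ) (hf : Continuous f) {C c : ℝ}
    (hb : ∀ s t, |t| ≤ s → |φ s * f t| ≤ C * exp (c * s)) :
    ∫ y, φ ‖y‖ * f (y 0) ∂(stdGaussian (EuclideanSpace ℝ (Fin n))) =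
      ∫ y, φ ‖y‖ * ∫ x, f (‖y‖ * x) ∂(coordLaw n)
        ∂(stdGaussian (EuclideanSpace ℝ (Fin n))) := by
  have hrot : ∀ᵐ θ ∂(sphereInput n 1),
      ∫ y, φ ‖y‖ * f ⟪y, θ⟫ ∂(stdGaussian (EuclideanSpace ℝ (Fin n))) =
      ∫ y, φ ‖y‖ * f (y 0) ∂(stdGaussian (EuclideanSpace ℝ (Fin n))) := by
    filter_upwards [norm_eq_of_sphereInput (n := n) 1] with θ hθ
    obtain ⟨T, hT⟩ := exists_isometry_map_eq (u := firstVec n) (v := θ)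
      (by rw [hθ, norm_firstVec]; simp)
    rw [← integral_isometry_stdGaussian T]
    simp_rw [LinearIsometryEquiv.norm_map, ← hT, LinearIsometryEquiv.inner_map_map, inner_firstVec]
  have hint : Integrable (fun p : EuclideanSpace ℝ (Fin n) × EuclideanSpace ℝ (Fin n) =>
      φ ‖p.2‖ * f ⟪p.2, p.1⟫) ((sphereInput n 1).prod (stdGaussian _)) := by
    refine Integrable.mono' (g := fun p => C * exp (c * ‖p.2‖))
      (((integrable_exp_norm_stdGaussian c).const_mul C).comp_snd _) ?_ ?_
    · exact ((hφ.comp (by fun_prop)).mul (hf.measurable.comp (by fun_prop))).aestronglyMeasurable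
    · have h1 : ∀ᵐ p ∂((sphereInput n 1).prod (stdGaussian (EuclideanSpace ℝ (Fin n)))),
          ‖p.1‖ = |(1 : ℝ)| := Measure.quasiMeasurePreserving_fst.ae (norm_eq_of_sphereInput 1)
      filter_upwards [h1] with p hp
      refine hb _ _ ((abs_real_inner_le_norm _ _).trans ?_)
      rw [hp]; simp
  calc ∫ y, φ ‖y‖ * f (y 0) ∂(stdGaussian (EuclideanSpace ℝ (Fin n)))
      = ∫ θ, ∫ y, φ ‖y‖ * f ⟪y, θ⟫ ∂(stdGaussian _) ∂(sphereInput n 1) := by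
        rw [integral_congr_ae hrot]; simp
    _ = ∫ y, ∫ θ, φ ‖y‖ * f ⟪y, θ⟫ ∂(sphereInput n 1) ∂(stdGaussian _) :=
        integral_integral_swap hint
    _ = _ := by
        congr 1
        ext y
        rw [integral_const_mul, integral_comp_inner_sphereInput hf]

end Gaussian

/-! ### Mutual information over the Gaussian channel -/

section Information

variable {n : ℕ}

/-- The density, with respect to the standard Gaussian measure, of the output of the Gaussian
channel with input law `P`. -/
noncomputable def outputDensity (P : Measure (EuclideanSpace ℝ (Fin n)))
    (y : EuclideanSpace ℝ (Fin n)) : ℝ := ∫ x, exp (⟪x, y⟫ - ‖x‖ ^ 2 / 2) ∂P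

/-- The mutual information in terms of the output density, as a real number. -/
noncomputable def realInformation (P : Measure (EuclideanSpace ℝ (Fin n))) : ℝ :=
  ∫ x, ‖x‖ ^ 2 / 2 ∂P -
    ∫ y, outputDensity P y * log (outputDensity P y) ∂(stdGaussian (EuclideanSpace ℝ (Fin n)))

/-- The divergence of the output law given the input `x` from the output law of the input law `Q`,
as a real number. -/
noncomputable def infoDensity (Q : Measure (EuclideanSpace ℝ (Fin n)))
    (x : EuclideanSpace ℝ (Fin n)) : ℝ :=
  ‖x‖ ^ 2 / 2 - ∫ z, log (outputDensity Q (x + z)) ∂(stdGaussian (EuclideanSpace ℝ (Fin n)))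

theorem integrable_stdGaussian_of_le {g : EuclideanSpace ℝ (Fin n) → ℝ} (hg : Measurable g)
    {C c : ℝ} (h : ∀ y, |g y| ≤ C * exp (c * ‖y‖)) :
    Integrable g (stdGaussian (EuclideanSpace ℝ (Fin n))) :=
  ((integrable_exp_norm_stdGaussian c).const_mul C).mono' hg.aestronglyMeasurable
    (Eventually.of_forall h)

variable {R : ℝ} {P Q : Measure (EuclideanSpace ℝ (Fin n))}

theorem IsAdmissibleInput.ae_norm_le (hP : IsAdmissibleInput n R P) : ∀ᵐ x ∂P, ‖x‖ ≤ R := by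
  filter_upwards [hP.2] with x hx
  simpa using hx

theorem IsAdmissibleInput.nonneg (hP : IsAdmissibleInput n R P) : 0 ≤ R := by
  have := hP.1
  obtain ⟨x, hx⟩ := hP.ae_norm_le.exists
  exact (norm_nonneg x).trans hx

theorem IsAdmissibleInput.integrable (hP : IsAdmissibleInput n R P)
    {f : EuclideanSpace ℝ (Fin n) → ℝ} (hf : Continuous f) : Integrable f P := by
  have := hP.1
  obtain ⟨C, hC⟩ :=
    (isCompact_closedBall (0 : EuclideanSpace ℝ (Fin n)) R).exists_bound_of_continuousOn
      hf.continuousOn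
  refine Integrable.of_bound hf.aestronglyMeasurable C ?_
  filter_upwards [hP.2] with x hx using hC x hx

theorem measurable_outputDensity [SFinite P] : Measurable (outputDensity P) := by
  have h : StronglyMeasurable (Function.uncurry fun (y x : EuclideanSpace ℝ (Fin n)) =>
      exp (⟪x, y⟫ - ‖x‖ ^ 2 / 2)) := by
    apply Continuous.stronglyMeasurable
    fun_prop
  exact h.integral_prod_right.measurable

theorem IsAdmissibleInput.outputDensity_le (hP : IsAdmissibleInput n R P)
    (y : EuclideanSpace ℝ (Fin n)) : outputDensity P y ≤ exp (R * ‖y‖) := by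
  have := hP.1
  calc outputDensity P y ≤ ∫ _, exp (R * ‖y‖) ∂P := by
        refine integral_mono_ae (hP.integrable (by fun_prop)) (integrable_const _) ?_
        filter_upwards [hP.ae_norm_le] with x hx
        refine exp_le_exp.2 ?_
        have h1 := real_inner_le_norm x y
        have h2 := mul_le_mul_of_nonneg_right hx (norm_nonneg y)
        have h3 := sq_nonneg ‖x‖
        linarith
    _ = exp (R * ‖y‖) := by simp

theorem IsAdmissibleInput.le_outputDensity (hP : IsAdmissibleInput n R P)
    (y : EuclideanSpace ℝ (Fin n)) : exp (-(R * ‖y‖ + R ^ 2 / 2)) ≤ outputDensity P y := by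
  have := hP.1
  calc exp (-(R * ‖y‖ + R ^ 2 / 2)) = ∫ _, exp (-(R * ‖y‖ + R ^ 2 / 2)) ∂P := by simp
    _ ≤ outputDensity P y := by
        refine integral_mono_ae (integrable_const _) (hP.integrable (by fun_prop)) ?_
        filter_upwards [hP.ae_norm_le] with x hx
        refine exp_le_exp.2 ?_
        have h1 := neg_le_of_abs_le (abs_real_inner_le_norm x y)
        have h2 := mul_le_mul_of_nonneg_right hx (norm_nonneg y)
        have h3 := pow_le_pow_left₀ (norm_nonneg x) hx 2
        linarith

theorem IsAdmissibleInput.outputDensity_pos (hP : IsAdmissibleInput n R P)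
    (y : EuclideanSpace ℝ (Fin n)) : 0 < outputDensity P y :=
  (exp_pos _).trans_le (hP.le_outputDensity y)

theorem IsAdmissibleInput.abs_log_outputDensity_le (hP : IsAdmissibleInput n R P)
    (y : EuclideanSpace ℝ (Fin n)) : |log (outputDensity P y)| ≤ R * ‖y‖ + R ^ 2 / 2 := by
  rw [abs_le]
  constructor
  · rw [le_log_iff_exp_le (hP.outputDensity_pos y)]
    exact hP.le_outputDensity y
  · rw [log_le_iff_le_exp (hP.outputDensity_pos y)]
    exact (hP.outputDensity_le y).trans (exp_le_exp.2 (by nlinarith [sq_nonneg R]))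

theorem map_prodMk_add_stdGaussian [SFinite P] :
    (P.prod (stdGaussian (EuclideanSpace ℝ (Fin n)))).map (fun p => (p.1, p.1 + p.2)) =
      (P.prod (stdGaussian (EuclideanSpace ℝ (Fin n)))).withDensity
        fun p => ENNReal.ofReal (exp (⟪p.1, p.2⟫ - ‖p.1‖ ^ 2 / 2)) := by
  ext S hS
  have hk : Measurable fun p : EuclideanSpace ℝ (Fin n) × EuclideanSpace ℝ (Fin n) =>
      ENNReal.ofReal (exp (⟪p.1, p.2⟫ - ‖p.1‖ ^ 2 / 2)) := by fun_prop
  rw [Measure.map_apply (by fun_prop) hS, Measure.prod_apply (hS.preimage (by fun_prop)),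
    withDensity_apply _ hS, ← lintegral_indicator hS,
    lintegral_prod _ (hk.indicator hS).aemeasurable]
  refine lintegral_congr fun x => ?_
  have hSx : MeasurableSet (Prod.mk x ⁻¹' S) := hS.preimage (by fun_prop)
  have h := congrArg (fun μ => μ (Prod.mk x ⁻¹' S)) (stdGaussian_map_const_add x)
  simp only at h
  rw [Measure.map_apply (by fun_prop) hSx, withDensity_apply _ hSx, ← lintegral_indicator hSx] at h
  exact h

theorem IsAdmissibleInput.map_add_stdGaussian (hP : IsAdmissibleInput n R P) :
    (P.prod (stdGaussian (EuclideanSpace ℝ (Fin n)))).map (fun p => p.1 + p.2) =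
      (stdGaussian (EuclideanSpace ℝ (Fin n))).withDensity
        fun y => ENNReal.ofReal (outputDensity P y) := by
  have := hP.1
  have h : (fun p : EuclideanSpace ℝ (Fin n) × EuclideanSpace ℝ (Fin n) => p.1 + p.2) =
      Prod.snd ∘ fun p => (p.1, p.1 + p.2) := rfl
  have hk : Measurable fun p : EuclideanSpace ℝ (Fin n) × EuclideanSpace ℝ (Fin n) =>
      ENNReal.ofReal (exp (⟪p.1, p.2⟫ - ‖p.1‖ ^ 2 / 2)) := by fun_prop
  rw [h, ← Measure.map_map (by fun_prop) (by fun_prop), map_prodMk_add_stdGaussian]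
  ext S hS
  have hS' := hS.preimage (measurable_snd : Measurable
    (Prod.snd : EuclideanSpace ℝ (Fin n) × EuclideanSpace ℝ (Fin n) → _))
  rw [Measure.map_apply (by fun_prop) hS, withDensity_apply _ hS', withDensity_apply _ hS,
    ← lintegral_indicator hS', ← lintegral_indicator hS,
    lintegral_prod_symm _ (hk.indicator hS').aemeasurable]
  refine lintegral_congr fun y => ?_
  by_cases hy : y ∈ S
  · rw [indicator_of_mem hy, outputDensity, ofReal_integral_eq_lintegral_ofReal
      (hP.integrable (by fun_prop)) (Eventually.of_forall fun x => (exp_pos _).le)]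
    refine lintegral_congr fun x => ?_
    rw [indicator_of_mem (by exact hy)]
  · rw [indicator_of_notMem hy]
    simp only [indicator, mem_preimage, hy, if_false, lintegral_zero]

theorem IsAdmissibleInput.integral_comp_add (hP : IsAdmissibleInput n R P)
    {φ : EuclideanSpace ℝ (Fin n) → ℝ} (hφ : Measurable φ) :
    ∫ p, φ (p.1 + p.2) ∂(P.prod (stdGaussian (EuclideanSpace ℝ (Fin n)))) =
      ∫ y, outputDensity P y * φ y ∂(stdGaussian (EuclideanSpace ℝ (Fin n))) := by
  have := hP.1
  rw [← integral_map (φ := fun p : EuclideanSpace ℝ (Fin n) × EuclideanSpace ℝ (Fin n) =>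
    p.1 + p.2) (by fun_prop) hφ.aestronglyMeasurable,
    hP.map_add_stdGaussian, integral_withDensity_eq_integral_toReal_smul
    (measurable_outputDensity.ennreal_ofReal) (by simp)]
  congr 1
  ext y
  rw [ENNReal.toReal_ofReal (hP.outputDensity_pos y).le, smul_eq_mul]

theorem IsAdmissibleInput.integrable_log_add (hP : IsAdmissibleInput n R P)
    (hQ : IsAdmissibleInput n R Q) :
    Integrable (fun p : EuclideanSpace ℝ (Fin n) × EuclideanSpace ℝ (Fin n) =>
      log (outputDensity Q (p.1 + p.2))) (P.prod (stdGaussian _)) := by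
  have := hP.1
  have := hQ.1
  have hn : Integrable (fun z => ‖z‖) (stdGaussian (EuclideanSpace ℝ (Fin n))) :=
    IsGaussian.integrable_id.norm
  refine Integrable.mono' (g := fun p => R * (R + ‖p.2‖) + R ^ 2 / 2)
    (((((integrable_const R).add hn).const_mul R).add (integrable_const _)).comp_snd _) ?_ ?_
  · exact ((measurable_outputDensity.comp (by fun_prop)).log).aestronglyMeasurable
  · have h1 : ∀ᵐ p ∂(P.prod (stdGaussian (EuclideanSpace ℝ (Fin n)))), ‖p.1‖ ≤ R :=
      Measure.quasiMeasurePreserving_fst.ae hP.ae_norm_le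
    filter_upwards [h1] with p hp
    refine (hQ.abs_log_outputDensity_le _).trans ?_
    have h2 := norm_add_le p.1 p.2
    have h3 := mul_le_mul_of_nonneg_left (h2.trans (add_le_add_left hp ‖p.2‖)) hP.nonneg
    linarith

theorem IsAdmissibleInput.integrable_inner (hP : IsAdmissibleInput n R P) :
    Integrable (fun p : EuclideanSpace ℝ (Fin n) × EuclideanSpace ℝ (Fin n) => ⟪p.1, p.2⟫)
      (P.prod (stdGaussian _)) := by
  have := hP.1
  have hn : Integrable (fun z => ‖z‖) (stdGaussian (EuclideanSpace ℝ (Fin n))) :=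
    IsGaussian.integrable_id.norm
  refine Integrable.mono' (g := fun p => R * ‖p.2‖) ((hn.const_mul R).comp_snd _)
    (by fun_prop) ?_
  have h1 : ∀ᵐ p ∂(P.prod (stdGaussian (EuclideanSpace ℝ (Fin n)))), ‖p.1‖ ≤ R :=
    Measure.quasiMeasurePreserving_fst.ae hP.ae_norm_le
  filter_upwards [h1] with p hp
  exact (abs_real_inner_le_norm _ _).trans (mul_le_mul_of_nonneg_right hp (norm_nonneg _))

theorem IsAdmissibleInput.integral_infoDensity (hP : IsAdmissibleInput n R P)
    (hQ : IsAdmissibleInput n R Q) :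
    Integrable (infoDensity Q) P ∧ ∫ x, infoDensity Q x ∂P = ∫ x, ‖x‖ ^ 2 / 2 ∂P -
      ∫ y, outputDensity P y * log (outputDensity Q y)
        ∂(stdGaussian (EuclideanSpace ℝ (Fin n))) := by
  have := hP.1
  have := hQ.1
  have hi := hP.integrable_log_add hQ
  have h2 : Integrable (fun x : EuclideanSpace ℝ (Fin n) => ‖x‖ ^ 2 / 2) P :=
    hP.integrable (by fun_prop)
  refine ⟨h2.sub hi.integral_prod_left, ?_⟩
  rw [← hP.integral_comp_add measurable_outputDensity.log, integral_prod _ hi,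
    ← integral_sub h2 hi.integral_prod_left]
  rfl

/-- For an admissible input the mutual information is finite and given by the output density. -/
theorem IsAdmissibleInput.channelInformation_eq (hP : IsAdmissibleInput n R P) :
    channelInformation n P = ENNReal.ofReal (realInformation P) ∧ 0 ≤ realInformation P := by
  have := hP.1
  set γ := stdGaussian (EuclideanSpace ℝ (Fin n)) with hγ
  set k : EuclideanSpace ℝ (Fin n) × EuclideanSpace ℝ (Fin n) → ℝ :=
    fun p => exp (⟪p.1, p.2⟫ - ‖p.1‖ ^ 2 / 2) with hk
  have hkm : Measurable k := by fun_prop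
  have hfm : Measurable (outputDensity P) := measurable_outputDensity
  set J := (P.prod γ).map (fun p => (p.1, p.1 + p.2)) with hJ
  set N := ((P.prod γ).map (fun p => p.1)).prod ((P.prod γ).map (fun p => p.1 + p.2)) with hN
  have : IsProbabilityMeasure J := Measure.isProbabilityMeasure_map (by fun_prop)
  have : IsProbabilityMeasure ((P.prod γ).map (fun p => p.1)) :=
    Measure.isProbabilityMeasure_map (by fun_prop)
  have : IsProbabilityMeasure ((P.prod γ).map (fun p => p.1 + p.2)) :=
    Measure.isProbabilityMeasure_map (by fun_prop)
  have hN' : N = (P.prod γ).withDensity fun p => ENNReal.ofReal (outputDensity P p.2) := by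
    rw [hN, hP.map_add_stdGaussian, ← prod_withDensity_right hfm.ennreal_ofReal]
    congr 1
    exact Measure.map_fst_prod.trans (by simp)
  have hJN : J = N.withDensity fun p => ENNReal.ofReal (k p / outputDensity P p.2) := by
    rw [hJ, map_prodMk_add_stdGaussian, hN', ← withDensity_mul _ (by fun_prop) (by fun_prop)]
    congr 1
    funext p
    have hp := hP.outputDensity_pos p.2
    rw [Pi.mul_apply, ← ENNReal.ofReal_mul hp.le, mul_div_cancel₀ _ hp.ne']
  have hac : J ≪ N := by
    rw [hJN]
    exact withDensity_absolutelyContinuous _ _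
  have hllr : llr J N =ᵐ[J] fun p => ⟪p.1, p.2⟫ - ‖p.1‖ ^ 2 / 2 - log (outputDensity P p.2) := by
    have h1 : J.rnDeriv N =ᵐ[N] fun p => ENNReal.ofReal (k p / outputDensity P p.2) := by
      conv_lhs => rw [hJN]
      exact Measure.rnDeriv_withDensity N (by fun_prop)
    filter_upwards [hac.ae_le h1] with p hp
    have h0 := hP.outputDensity_pos p.2
    rw [llr, hp, ENNReal.toReal_ofReal (div_pos (exp_pos _) h0).le,
      log_div (exp_pos _).ne' h0.ne', log_exp]
  have hmeas : Measurable fun p : EuclideanSpace ℝ (Fin n) × EuclideanSpace ℝ (Fin n) =>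
      ⟪p.1, p.2⟫ - ‖p.1‖ ^ 2 / 2 - log (outputDensity P p.2) := by fun_prop
  have hsq : Integrable (fun p : EuclideanSpace ℝ (Fin n) × EuclideanSpace ℝ (Fin n) =>
      ‖p.1‖ ^ 2 / 2) (P.prod γ) :=
    (hP.integrable (f := fun x => ‖x‖ ^ 2 / 2) (by fun_prop)).comp_fst _
  have hcomp : (fun p : EuclideanSpace ℝ (Fin n) × EuclideanSpace ℝ (Fin n) =>
      ⟪p.1, p.1 + p.2⟫ - ‖p.1‖ ^ 2 / 2 - log (outputDensity P (p.1 + p.2))) =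
      fun p => (‖p.1‖ ^ 2 / 2 + ⟪p.1, p.2⟫) - log (outputDensity P (p.1 + p.2)) := by
    funext p
    rw [inner_add_right, real_inner_self_eq_norm_sq]
    ring
  have hint0 : Integrable (fun p : EuclideanSpace ℝ (Fin n) × EuclideanSpace ℝ (Fin n) =>
      ⟪p.1, p.1 + p.2⟫ - ‖p.1‖ ^ 2 / 2 - log (outputDensity P (p.1 + p.2))) (P.prod γ) := by
    rw [hcomp]
    exact (hsq.add hP.integrable_inner).sub (hP.integrable_log_add hP)
  have hint : Integrable (llr J N) J := by
    rw [integrable_congr hllr, hJ, integrable_map_measure hmeas.aestronglyMeasurable (by fun_prop)]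
    exact hint0
  have hval : ∫ p, llr J N p ∂J = realInformation P := by
    rw [integral_congr_ae hllr, hJ, integral_map (by fun_prop) hmeas.aestronglyMeasurable]
    simp only
    rw [hcomp, integral_sub (by exact hsq.add hP.integrable_inner) (hP.integrable_log_add hP),
      integral_add hsq hP.integrable_inner, hP.integral_comp_add measurable_outputDensity.log,
      integral_prod _ hP.integrable_inner, realInformation,
      integral_fun_fst (fun x : EuclideanSpace ℝ (Fin n) => ‖x‖ ^ 2 / 2)]
    simp_rw [hγ, integral_inner_stdGaussian]
    simp
  have h1 := InformationTheory.klDiv_of_ac_of_integrable hac hint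
  have h2 := InformationTheory.integral_llr_add_sub_measure_univ_nonneg hac hint
  rw [hval] at h1 h2
  simp only [probReal_univ, add_sub_cancel_right] at h1 h2
  exact ⟨h1, h2⟩

theorem IsAdmissibleInput.integrable_outputDensity_mul_log (hP : IsAdmissibleInput n R P)
    (hQ : IsAdmissibleInput n R Q) :
    Integrable (fun y => outputDensity P y * log (outputDensity Q y)) (stdGaussian _) := by
  have := hP.1
  have := hQ.1
  refine integrable_stdGaussian_of_le (C := exp (R ^ 2 / 2)) (c := 2 * R)
    (measurable_outputDensity.mul measurable_outputDensity.log) fun y => ?_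
  rw [abs_mul, abs_of_pos (hP.outputDensity_pos y)]
  have h1 := hP.outputDensity_le y
  have h2 : |log (outputDensity Q y)| ≤ exp (R * ‖y‖ + R ^ 2 / 2) :=
    (hQ.abs_log_outputDensity_le y).trans (by linarith [add_one_le_exp (R * ‖y‖ + R ^ 2 / 2)])
  refine (mul_le_mul h1 h2 (abs_nonneg _) (exp_pos _).le).trans_eq ?_
  rw [← exp_add, ← exp_add]
  ring_nf

theorem IsAdmissibleInput.integrable_outputDensity (hP : IsAdmissibleInput n R P) :
    Integrable (outputDensity P) (stdGaussian _) := by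
  have := hP.1
  refine integrable_stdGaussian_of_le (C := 1) (c := R) measurable_outputDensity fun y => ?_
  rw [abs_of_pos (hP.outputDensity_pos y), one_mul]
  exact hP.outputDensity_le y

theorem IsAdmissibleInput.integral_outputDensity (hP : IsAdmissibleInput n R P) :
    ∫ y, outputDensity P y ∂(stdGaussian (EuclideanSpace ℝ (Fin n))) = 1 := by
  have := hP.1
  have := hP.integral_comp_add (φ := fun _ => 1) measurable_const
  simpa using this.symm

/-- Gibbs' inequality for the output densities. -/
theorem IsAdmissibleInput.realInformation_le (hP : IsAdmissibleInput n R P)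
    (hQ : IsAdmissibleInput n R Q) : realInformation P ≤ ∫ x, infoDensity Q x ∂P := by
  rw [(hP.integral_infoDensity hQ).2, realInformation]
  refine sub_le_sub_left ?_ _
  have h : ∫ y, (outputDensity P y * log (outputDensity Q y)
      - outputDensity P y * log (outputDensity P y)) ∂(stdGaussian (EuclideanSpace ℝ (Fin n))) ≤
      ∫ y, (outputDensity Q y - outputDensity P y)
        ∂(stdGaussian (EuclideanSpace ℝ (Fin n))) := by
    refine integral_mono ((hP.integrable_outputDensity_mul_log hQ).sub
      (hP.integrable_outputDensity_mul_log hP))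
      (hQ.integrable_outputDensity.sub hP.integrable_outputDensity) fun y => ?_
    have hp := hP.outputDensity_pos y
    have hq := hQ.outputDensity_pos y
    have := log_le_sub_one_of_pos (div_pos hq hp)
    rw [log_div hq.ne' hp.ne'] at this
    have h2 := mul_le_mul_of_nonneg_left this hp.le
    have h3 : outputDensity P y * (outputDensity Q y / outputDensity P y - 1) =
      outputDensity Q y - outputDensity P y := by field_simp
    simp only
    linarith
  rw [integral_sub (hP.integrable_outputDensity_mul_log hQ)
      (hP.integrable_outputDensity_mul_log hP),
    integral_sub hQ.integrable_outputDensity hP.integrable_outputDensity,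
    hP.integral_outputDensity, hQ.integral_outputDensity] at h
  linarith

theorem IsAdmissibleInput.realInformation_self (hQ : IsAdmissibleInput n R Q) :
    realInformation Q = ∫ x, infoDensity Q x ∂Q := by
  rw [(hQ.integral_infoDensity hQ).2, realInformation]

/-- The loss in Gibbs' inequality is at most the `χ²` divergence of the output laws. -/
theorem IsAdmissibleInput.le_realInformation (hP : IsAdmissibleInput n R P)
    (hQ : IsAdmissibleInput n R Q) :
    ∫ x, infoDensity Q x ∂P -
      ∫ y, (outputDensity P y - outputDensity Q y) ^ 2 / outputDensity Q y
        ∂(stdGaussian (EuclideanSpace ℝ (Fin n))) ≤ realInformation P := by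
  have := hP.1
  have := hQ.1
  rw [(hP.integral_infoDensity hQ).2, realInformation]
  have hchi : Integrable (fun y => (outputDensity P y - outputDensity Q y) ^ 2 / outputDensity Q y)
      (stdGaussian (EuclideanSpace ℝ (Fin n))) := by
    refine integrable_stdGaussian_of_le (C := exp (R ^ 2 / 2)) (c := 3 * R)
      (((measurable_outputDensity.sub measurable_outputDensity).pow_const 2).div
        measurable_outputDensity) fun y => ?_
    have hp := hP.outputDensity_pos y
    have hq := hQ.outputDensity_pos y
    have hp' := hP.outputDensity_le y
    have hq' := hQ.outputDensity_le y
    rw [abs_of_nonneg (div_nonneg (sq_nonneg _) hq.le)]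
    have h1 : (outputDensity P y - outputDensity Q y) ^ 2 ≤ exp (R * ‖y‖) ^ 2 :=
      sq_le_sq' (by linarith) (by linarith)
    have h2 := hQ.le_outputDensity y
    refine (div_le_div₀ (by positivity) h1 (exp_pos _) h2).trans_eq ?_
    rw [← exp_nat_mul, ← exp_sub, ← exp_add]
    congr 1
    push_cast
    ring
  have h : ∫ y, (outputDensity P y * log (outputDensity P y)
      - outputDensity P y * log (outputDensity Q y)) ∂(stdGaussian (EuclideanSpace ℝ (Fin n))) ≤
      ∫ y, ((outputDensity P y - outputDensity Q y) ^ 2 / outputDensity Q y +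
        (outputDensity P y - outputDensity Q y))
        ∂(stdGaussian (EuclideanSpace ℝ (Fin n))) := by
    refine integral_mono ((hP.integrable_outputDensity_mul_log hP).sub
      (hP.integrable_outputDensity_mul_log hQ))
      (hchi.add (hP.integrable_outputDensity.sub hQ.integrable_outputDensity)) fun y => ?_
    have hp := hP.outputDensity_pos y
    have hq := hQ.outputDensity_pos y
    have := log_le_sub_one_of_pos (div_pos hp hq)
    rw [log_div hp.ne' hq.ne'] at this
    have h2 := mul_le_mul_of_nonneg_left this hp.le
    have h3 : outputDensity P y * (outputDensity P y / outputDensity Q y - 1) =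
      (outputDensity P y - outputDensity Q y) ^ 2 / outputDensity Q y +
        (outputDensity P y - outputDensity Q y) := by field_simp; ring
    simp only
    linarith
  rw [integral_sub (hP.integrable_outputDensity_mul_log hP)
      (hP.integrable_outputDensity_mul_log hQ),
    integral_add hchi (by exact hP.integrable_outputDensity.sub hQ.integrable_outputDensity),
    integral_sub hP.integrable_outputDensity hQ.integrable_outputDensity,
    hP.integral_outputDensity, hQ.integral_outputDensity] at h
  linarith

/-- Sufficiency of the first-order optimality condition. -/
theorem IsAdmissibleInput.isOptimalInput_of_infoDensity_le (hQ : IsAdmissibleInput n R Q)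
    (h : ∀ x, ‖x‖ ≤ R → infoDensity Q x ≤ realInformation Q) : IsOptimalInput n R Q := by
  refine ⟨hQ, fun P hP => ?_⟩
  have := hP.1
  rw [hP.channelInformation_eq.1, hQ.channelInformation_eq.1]
  refine ENNReal.ofReal_le_ofReal ((hP.realInformation_le hQ).trans ?_)
  calc ∫ x, infoDensity Q x ∂P ≤ ∫ _, realInformation Q ∂P := by
        refine integral_mono_ae (hP.integral_infoDensity hQ).1 (integrable_const _) ?_
        filter_upwards [hP.ae_norm_le] with x hx using h x hx
    _ = realInformation Q := by simp

/-- The first-order optimality condition, tested on mixtures `(1 - t) Q + t δₓ`. -/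
theorem IsOptimalInput.infoDensity_le (hQ : IsOptimalInput n R Q)
    {x : EuclideanSpace ℝ (Fin n)} (hx : ‖x‖ ≤ R) : infoDensity Q x ≤ realInformation Q := by
  obtain ⟨hQ, hopt⟩ := hQ
  have := hQ.1
  set K := ∫ y, (exp (⟪x, y⟫ - ‖x‖ ^ 2 / 2) - outputDensity Q y) ^ 2 / outputDensity Q y
    ∂(stdGaussian (EuclideanSpace ℝ (Fin n))) with hK
  have hδ : IsAdmissibleInput n R (Measure.dirac x) :=
    ⟨inferInstance, by rw [ae_dirac_eq]; simpa using hx⟩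
  have key : ∀ t ∈ Ioo (0 : ℝ) 1, infoDensity Q x - realInformation Q ≤ t * K := by
    rintro t ⟨ht0, ht1⟩
    have ht1' : 0 ≤ 1 - t := by linarith
    set P : Measure (EuclideanSpace ℝ (Fin n)) :=
      ENNReal.ofReal (1 - t) • Q + ENNReal.ofReal t • Measure.dirac x with hPdef
    have hP : IsAdmissibleInput n R P := by
      refine ⟨⟨?_⟩, ?_⟩
      · simp only [hPdef, Measure.add_apply, Measure.smul_apply, measure_univ, smul_eq_mul, mul_one]
        rw [← ENNReal.ofReal_add ht1' ht0.le]
        simp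
      · rw [hPdef, ae_add_measure_iff]
        exact ⟨Measure.ae_smul_measure hQ.2 _, Measure.ae_smul_measure hδ.2 _⟩
    have hmix : ∀ f : EuclideanSpace ℝ (Fin n) → ℝ, Integrable f Q →
        Integrable f (Measure.dirac x) → ∫ x, f x ∂P = (1 - t) * ∫ x, f x ∂Q + t * f x := by
      intro f h1 h2
      rw [hPdef, integral_add_measure (h1.smul_measure (by simp)) (h2.smul_measure (by simp)),
        integral_smul_measure, integral_smul_measure, ENNReal.toReal_ofReal ht1',
        ENNReal.toReal_ofReal ht0.le, integral_dirac, smul_eq_mul, smul_eq_mul]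
    have h1 := hP.le_realInformation hQ
    have h2 : realInformation P ≤ realInformation Q := by
      have := hopt P hP
      rwa [hP.channelInformation_eq.1, hQ.channelInformation_eq.1,
        ENNReal.ofReal_le_ofReal_iff hQ.channelInformation_eq.2] at this
    rw [hmix _ (hQ.integral_infoDensity hQ).1 (hδ.integral_infoDensity hQ).1,
      ← hQ.realInformation_self] at h1
    have h3 : ∀ y, outputDensity P y =
        (1 - t) * outputDensity Q y + t * exp (⟪x, y⟫ - ‖x‖ ^ 2 / 2) := fun y =>
      hmix _ (hQ.integrable (by fun_prop)) (hδ.integrable (by fun_prop))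
    have h4 : ∫ y, (outputDensity P y - outputDensity Q y) ^ 2 / outputDensity Q y
        ∂(stdGaussian (EuclideanSpace ℝ (Fin n))) = t ^ 2 * K := by
      rw [hK, ← integral_const_mul]
      congr 1
      ext y
      rw [h3]
      ring
    rw [h4] at h1
    have h5 : t * (infoDensity Q x - realInformation Q) ≤ t * (t * K) := by nlinarith
    exact le_of_mul_le_mul_left h5 ht0
  have hlim : Tendsto (fun t : ℝ => t * K) (𝓝[>] 0) (𝓝 (0 * K)) :=
    (tendsto_id.mono_left nhdsWithin_le_nhds).mul_const K
  rw [zero_mul] at hlim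
  have := ge_of_tendsto hlim (by
    filter_upwards [Ioo_mem_nhdsGT (zero_lt_one (α := ℝ))] with t ht using key t ht)
  linarith

end Information

/-! ### The uniform input on the sphere -/

section SphereInfo

variable {n : ℕ} [NeZero n]

/-- The mean of the first coordinate under the law on the unit sphere with density proportional to
`θ ↦ exp ⟪v, θ⟫`. -/
noncomputable def tiltedMean (v : EuclideanSpace ℝ (Fin n)) : ℝ :=
  (∫ θ, θ 0 * exp ⟪v, θ⟫ ∂(sphereInput n 1)) / ∫ θ, exp ⟪v, θ⟫ ∂(sphereInput n 1)

theorem integral_exp_inner_sphereInput (v : EuclideanSpace ℝ (Fin n)) :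
    ∫ θ, exp ⟪v, θ⟫ ∂(sphereInput n 1) = sphereMGF n ‖v‖ :=
  integral_comp_inner_sphereInput continuous_exp v

/-- Averaging `θ` with its image under the reflection fixing `v` removes the component orthogonal to
`v`, so the tilted mean vector is parallel to `v`. -/
theorem tiltedMean_eq (v : EuclideanSpace ℝ (Fin n)) :
    tiltedMean v = v 0 / ‖v‖ * sphereRatio n ‖v‖ := by
  set T := (ℝ ∙ v).reflection with hT
  have hTv : T v = v :=
    Submodule.reflection_mem_subspace_eq_self (Submodule.mem_span_singleton_self v)
  have hTe : ∀ θ : EuclideanSpace ℝ (Fin n), θ 0 + (T θ) 0 = 2 * (v 0 / ‖v‖ ^ 2) * ⟪v, θ⟫ := by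
    intro θ
    rw [hT, Submodule.reflection_apply, Submodule.starProjection_singleton]
    simp
    ring
  have i : ∀ f : EuclideanSpace ℝ (Fin n) → ℝ, Continuous f → Integrable f (sphereInput n 1) :=
    fun f hf => integrable_sphereInput hf 1
  have h1 : ∫ θ, (T θ) 0 * exp ⟪v, θ⟫ ∂(sphereInput n 1) =
      ∫ θ, θ 0 * exp ⟪v, θ⟫ ∂(sphereInput n 1) := by
    conv_rhs => rw [← sphereInput_one_map T]
    rw [integral_map T.continuous.aemeasurable (by fun_prop)]
    congr 1
    ext θ
    conv_rhs => rw [← hTv]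
    rw [LinearIsometryEquiv.inner_map_map]
  have h2 : ∫ θ, (θ 0 + (T θ) 0) * exp ⟪v, θ⟫ ∂(sphereInput n 1) =
      2 * ∫ θ, θ 0 * exp ⟪v, θ⟫ ∂(sphereInput n 1) := by
    simp_rw [add_mul]
    rw [integral_add (i _ (by fun_prop)) (i _ (by fun_prop)), h1]
    ring
  have h3 : ∫ θ, ⟪v, θ⟫ * exp ⟪v, θ⟫ ∂(sphereInput n 1) = ‖v‖ * sphereMGFDeriv n ‖v‖ := by
    rw [integral_comp_inner_sphereInput (f := fun t => t * exp t) (by fun_prop) v,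
      sphereMGFDeriv, ← integral_const_mul]
    congr 1; ext x; ring
  simp_rw [hTe, mul_assoc] at h2
  rw [integral_const_mul, integral_const_mul, h3] at h2
  rw [tiltedMean, integral_exp_inner_sphereInput, sphereRatio]
  have h4 : ∫ θ, θ 0 * exp ⟪v, θ⟫ ∂(sphereInput n 1) = v 0 / ‖v‖ * sphereMGFDeriv n ‖v‖ := by
    rcases eq_or_ne ‖v‖ 0 with h0 | h0
    · rw [h0] at h2 ⊢
      simp at h2 ⊢
      exact h2
    · field_simp at h2 ⊢
      linarith
  rw [h4]
  ring

theorem abs_tiltedMean_le (v : EuclideanSpace ℝ (Fin n)) : |tiltedMean v| ≤ 1 := by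
  rw [tiltedMean_eq, abs_mul]
  refine mul_le_one₀ ?_ (abs_nonneg _) (abs_sphereRatio_le _)
  rw [abs_div, abs_norm]
  exact div_le_one_of_le₀ (PiLp.norm_apply_le v 0) (norm_nonneg v)

theorem continuous_tiltedMean :
    Continuous (tiltedMean : EuclideanSpace ℝ (Fin n) → ℝ) := by
  refine Continuous.div₀ (continuous_integral_sphereInput
    (f := fun v (θ : EuclideanSpace ℝ (Fin n)) => θ 0 * exp ⟪v, θ⟫) (by fun_prop) 1)
    (continuous_integral_sphereInput
    (f := fun v (θ : EuclideanSpace ℝ (Fin n)) => exp ⟪v, θ⟫) (by fun_prop) 1) fun v => ?_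
  rw [integral_exp_inner_sphereInput]
  exact (sphereMGF_pos _).ne'

theorem tiltedMean_smul {R : ℝ} (hR : 0 < R) (y : EuclideanSpace ℝ (Fin n)) :
    tiltedMean (R • y) = y 0 / ‖y‖ * sphereRatio n (R * ‖y‖) := by
  rw [tiltedMean_eq, norm_smul, norm_of_nonneg hR.le, PiLp.smul_apply, smul_eq_mul,
    mul_div_mul_left _ _ hR.ne']

theorem hasDerivAt_log_sphereMGF (R : ℝ) (z : EuclideanSpace ℝ (Fin n)) (r : ℝ) :
    HasDerivAt (fun r : ℝ => log (sphereMGF n ‖R • (r • firstVec n + z)‖))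
      (R * tiltedMean (R • (r • firstVec n + z))) r := by
  have hin : ∀ (r : ℝ) (θ : EuclideanSpace ℝ (Fin n)),
      ⟪R • (r • firstVec n + z), θ⟫ = R * (r * θ 0 + ⟪z, θ⟫) := by
    intro r θ
    rw [real_inner_smul_left, inner_add_left, real_inner_smul_left, real_inner_comm, inner_firstVec]
  have h := (hasDerivAt_integral_of_dominated_loc_of_deriv_le (μ := sphereInput n 1)
    (F := fun (r : ℝ) θ => exp ⟪R • (r • firstVec n + z), θ⟫)
    (F' := fun (r : ℝ) θ => R * (θ 0 * exp ⟪R • (r • firstVec n + z), θ⟫))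
    (bound := fun _ => |R| * exp (|R| * (|r| + 1 + ‖z‖))) (x₀ := r) (Metric.ball_mem_nhds r one_pos)
    (Eventually.of_forall fun r => by fun_prop)
    (integrable_sphereInput (by fun_prop) 1) (by fun_prop) ?_ (integrable_const _) ?_).2
  · rw [integral_const_mul] at h
    simp_rw [integral_exp_inner_sphereInput] at h
    have h2 := h.log (sphereMGF_pos _).ne'
    rw [tiltedMean, integral_exp_inner_sphereInput, ← mul_div_assoc]
    exact h2
  · filter_upwards [norm_eq_of_sphereInput (n := n) 1] with θ hθ x hx
    rw [abs_one] at hθ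
    have h0 : |θ 0| ≤ 1 := hθ ▸ PiLp.norm_apply_le θ 0
    have hx' : |x| ≤ |r| + 1 := by
      have h1 : |x - r| < 1 := by simpa [Real.dist_eq] using hx
      have h2 := abs_sub_abs_le_abs_sub x r
      linarith
    rw [norm_mul, norm_mul, norm_eq_abs, norm_eq_abs, norm_eq_abs, abs_exp]
    refine mul_le_mul_of_nonneg_left ?_ (abs_nonneg R)
    refine (mul_le_of_le_one_left (exp_pos _).le h0).trans (exp_le_exp.2 ?_)
    refine (real_inner_le_norm _ _).trans ?_
    rw [hθ, mul_one, norm_smul, norm_eq_abs]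
    refine mul_le_mul_of_nonneg_left ((norm_add_le _ _).trans ?_) (abs_nonneg R)
    rw [norm_smul, norm_firstVec, mul_one, norm_eq_abs]
    linarith
  · refine Eventually.of_forall fun θ x _ => ?_
    simp_rw [hin]
    have h1 : HasDerivAt (fun x : ℝ => R * (x * θ 0 + ⟪z, θ⟫)) (R * (1 * θ 0)) x :=
      (((hasDerivAt_id x).mul_const (θ 0)).add_const _).const_mul R
    exact h1.exp.congr_deriv (by ring)

theorem abs_log_sphereMGF_le (s : ℝ) : |log (sphereMGF n s)| ≤ |s| := by
  rw [abs_of_nonneg (log_nonneg (one_le_sphereMGF s)), log_le_iff_le_exp (sphereMGF_pos s)]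
  exact sphereMGF_le s

/-- The mean of `tiltedMean (R • Y)` for `Y` normal with mean `r e₁` and identity covariance. -/
noncomputable def meanDrift (n : ℕ) [NeZero n] (R r : ℝ) : ℝ :=
  ∫ z, tiltedMean (R • (r • firstVec n + z)) ∂(stdGaussian (EuclideanSpace ℝ (Fin n)))

theorem continuous_meanDrift : Continuous (Function.uncurry (meanDrift n)) := by
  have hc := continuous_tiltedMean (n := n)
  refine continuous_of_dominated (bound := fun _ => 1) (fun p => ?_) (fun p => ?_)
    (integrable_const _) ?_
  · exact (hc.comp (by fun_prop)).aestronglyMeasurable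
  · exact Eventually.of_forall fun z => abs_tiltedMean_le _
  · exact Eventually.of_forall fun z => hc.comp (by fun_prop)

theorem abs_meanDrift_le (R r : ℝ) : |meanDrift n R r| ≤ 1 := by
  refine (norm_integral_le_of_norm_le_const (C := 1)
    (Eventually.of_forall fun z => (norm_eq_abs _).trans_le (abs_tiltedMean_le _))).trans ?_
  simp

theorem sphereInput_admissible {R : ℝ} (hR : 0 ≤ R) : IsAdmissibleInput n R (sphereInput n R) := by
  refine ⟨inferInstance, ?_⟩
  filter_upwards [norm_eq_of_sphereInput (n := n) R] with x hx
  simp [hx, abs_of_nonneg hR]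

theorem outputDensity_sphereInput (R : ℝ) (y : EuclideanSpace ℝ (Fin n)) :
    outputDensity (sphereInput n R) y = exp (-(R ^ 2 / 2)) * sphereMGF n ‖R • y‖ := by
  rw [outputDensity, ← integral_exp_inner_sphereInput, ← integral_const_mul, sphereInput_eq_map,
    integral_map (by fun_prop) (by fun_prop)]
  refine integral_congr_ae ?_
  filter_upwards [norm_eq_of_sphereInput (n := n) 1] with θ hθ
  rw [abs_one] at hθ
  rw [← exp_add, norm_smul, hθ, mul_one, norm_eq_abs, sq_abs, real_inner_smul_left,
    real_inner_smul_left, real_inner_comm]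
  ring_nf

theorem integrable_log_sphereMGF (R : ℝ) (x : EuclideanSpace ℝ (Fin n)) :
    Integrable (fun z => log (sphereMGF n ‖R • (x + z)‖))
      (stdGaussian (EuclideanSpace ℝ (Fin n))) := by
  have hn : Integrable (fun z => ‖z‖) (stdGaussian (EuclideanSpace ℝ (Fin n))) :=
    IsGaussian.integrable_id.norm
  refine Integrable.mono' (g := fun z => |R| * (‖x‖ + ‖z‖))
    (((integrable_const _).add hn).const_mul _) ?_ ?_
  · exact ((continuous_sphereMGF.measurable.comp (by fun_prop)).log).aestronglyMeasurable
  · refine Eventually.of_forall fun z => (abs_log_sphereMGF_le _).trans ?_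
    rw [abs_norm, norm_smul, norm_eq_abs]
    exact mul_le_mul_of_nonneg_left (norm_add_le _ _) (abs_nonneg R)

theorem infoDensity_sphereInput (R : ℝ) (x : EuclideanSpace ℝ (Fin n)) :
    infoDensity (sphereInput n R) x = ‖x‖ ^ 2 / 2 + R ^ 2 / 2 -
      ∫ z, log (sphereMGF n ‖R • (x + z)‖) ∂(stdGaussian (EuclideanSpace ℝ (Fin n))) := by
  have : ∀ z, log (outputDensity (sphereInput n R) (x + z)) =
      -(R ^ 2 / 2) + log (sphereMGF n ‖R • (x + z)‖) := by
    intro z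
    rw [outputDensity_sphereInput, log_mul (exp_pos _).ne' (sphereMGF_pos _).ne', log_exp]
  simp_rw [infoDensity, this]
  rw [integral_add (integrable_const _) (integrable_log_sphereMGF R x)]
  simp
  ring

theorem infoDensity_sphereInput_congr (R : ℝ) {x y : EuclideanSpace ℝ (Fin n)} (h : ‖x‖ = ‖y‖) :
    infoDensity (sphereInput n R) x = infoDensity (sphereInput n R) y := by
  obtain ⟨T, rfl⟩ := exists_isometry_map_eq h
  rw [infoDensity_sphereInput, infoDensity_sphereInput, T.norm_map,
    ← integral_isometry_stdGaussian T fun z => log (sphereMGF n ‖R • (T x + z)‖)]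
  simp_rw [norm_smul, ← map_add, LinearIsometryEquiv.norm_map]

theorem realInformation_sphereInput {R : ℝ} (hR : 0 ≤ R) :
    realInformation (sphereInput n R) = infoDensity (sphereInput n R) (R • firstVec n) := by
  rw [(sphereInput_admissible hR).realInformation_self]
  rw [integral_congr_ae (g := fun _ => infoDensity (sphereInput n R) (R • firstVec n))]
  · simp
  · filter_upwards [norm_eq_of_sphereInput (n := n) R] with x hx
    exact infoDensity_sphereInput_congr R (by rw [hx, norm_smul, norm_firstVec, mul_one]; rfl)

theorem hasDerivAt_infoDensity (R r : ℝ) :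
    HasDerivAt (fun r : ℝ => infoDensity (sphereInput n R) (r • firstVec n))
      (r - R * meanDrift n R r) r := by
  have hG := (hasDerivAt_integral_of_dominated_loc_of_deriv_le
    (μ := stdGaussian (EuclideanSpace ℝ (Fin n)))
    (F := fun (r : ℝ) z => log (sphereMGF n ‖R • (r • firstVec n + z)‖))
    (F' := fun (r : ℝ) z => R * tiltedMean (R • (r • firstVec n + z)))
    (bound := fun _ => |R|) (x₀ := r) (Metric.ball_mem_nhds r one_pos)
    (Eventually.of_forall fun r => (integrable_log_sphereMGF R _).aestronglyMeasurable)
    (integrable_log_sphereMGF R _)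
    (((continuous_tiltedMean (n := n)).comp (by fun_prop)).const_mul R).aestronglyMeasurable
    (Eventually.of_forall fun z x _ => ?_) (integrable_const _)
    (Eventually.of_forall fun z x _ => hasDerivAt_log_sphereMGF R z x)).2
  · rw [integral_const_mul] at hG
    have h1 : HasDerivAt (fun r : ℝ => r ^ 2 / 2 + R ^ 2 / 2) r r := by
      have := ((hasDerivAt_pow 2 r).div_const 2).add_const (R ^ 2 / 2)
      simpa using this
    have e : (fun r : ℝ => infoDensity (sphereInput n R) (r • firstVec n)) = fun r : ℝ =>
        (r ^ 2 / 2 + R ^ 2 / 2) - ∫ z, log (sphereMGF n ‖R • (r • firstVec n + z)‖)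
          ∂(stdGaussian (EuclideanSpace ℝ (Fin n))) := by
      funext r
      rw [infoDensity_sphereInput, norm_smul r, norm_firstVec, mul_one, norm_eq_abs, sq_abs]
    rw [e]
    exact h1.fun_sub hG
  · rw [norm_mul]
    exact mul_le_of_le_one_right (abs_nonneg R) (abs_tiltedMean_le _)

/-- The comparison of the centre of the ball with its boundary. -/
theorem infoDensity_sub_eq (R : ℝ) :
    infoDensity (sphereInput n R) (R • firstVec n) - infoDensity (sphereInput n R) 0 =
      R ^ 2 * (1 / 2 - ∫ u in (0 : ℝ)..1, meanDrift n R (u * R)) := by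
  have hc : Continuous (meanDrift n R) :=
    continuous_meanDrift.uncurry_left R
  have hcont : Continuous fun r => r - R * meanDrift n R r := by fun_prop
  have h := intervalIntegral.integral_eq_sub_of_hasDerivAt (a := 0) (b := R)
    (f := fun r : ℝ => infoDensity (sphereInput n R) (r • firstVec n))
    (f' := fun r => r - R * meanDrift n R r)
    (fun r _ => hasDerivAt_infoDensity (n := n) R r) (hcont.intervalIntegrable _ _)
  simp only [zero_smul] at h
  rw [← h, intervalIntegral.integral_sub (continuous_id'.intervalIntegrable _ _)
    ((by fun_prop : Continuous fun r => R * meanDrift n R r).intervalIntegrable _ _),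
    intervalIntegral.integral_const_mul,
    integral_id]
  have h2 := intervalIntegral.mul_integral_comp_mul_right (f := meanDrift n R) (a := 0) (b := 1) R
  rw [zero_mul, one_mul] at h2
  rw [← h2]
  ring

theorem meanDrift_eq_integral {R r : ℝ} (hR : 0 < R) :
    meanDrift n R r = exp (-(r ^ 2 / 2)) *
      ∫ y, sphereRatio n (R * ‖y‖) * sphereMGFDeriv n (r * ‖y‖)
        ∂(stdGaussian (EuclideanSpace ℝ (Fin n))) := by
  have hm : Measurable fun y : EuclideanSpace ℝ (Fin n) => tiltedMean (R • y) :=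
    (continuous_tiltedMean.comp (by fun_prop)).measurable
  have h := integral_norm_mul_coord (n := n) (φ := fun s => sphereRatio n (R * s) / s)
    (f := fun t => t * exp (r * t)) ((continuous_sphereRatio.measurable.comp (by fun_prop)).div
      measurable_id) (by fun_prop) (C := 1) (c := |r|) ?_
  · rw [meanDrift, integral_const_add_stdGaussian (r • firstVec n) hm, ← integral_const_mul]
    have e1 : ∀ y : EuclideanSpace ℝ (Fin n),
        exp (⟪r • firstVec n, y⟫ - ‖r • firstVec n‖ ^ 2 / 2) * tiltedMean (R • y) =
        exp (-(r ^ 2 / 2)) * (sphereRatio n (R * ‖y‖) / ‖y‖ * (y 0 * exp (r * y 0))) := by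
      intro y
      rw [tiltedMean_smul hR, real_inner_smul_left, real_inner_comm, inner_firstVec, norm_smul,
        norm_firstVec, mul_one, norm_eq_abs, sq_abs, sub_eq_neg_add, exp_add]
      ring
    simp_rw [e1]
    rw [integral_const_mul, h, integral_const_mul]
    congr 2
    ext y
    have e2 : ∫ x, ‖y‖ * x * exp (r * (‖y‖ * x)) ∂(coordLaw n) =
        ‖y‖ * sphereMGFDeriv n (r * ‖y‖) := by
      rw [sphereMGFDeriv, ← integral_const_mul]
      congr 1; ext x; ring_nf
    rw [e2]
    rcases eq_or_ne ‖y‖ 0 with h0 | h0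
    · simp [h0, sphereRatio_zero]
    · field_simp
  · intro s t hts
    have hs : 0 ≤ s := (abs_nonneg t).trans hts
    have h1 : |sphereRatio n (R * s) / s * t| ≤ 1 := by
      rw [div_mul_eq_mul_div, mul_div_assoc, abs_mul, abs_div, abs_of_nonneg hs]
      exact mul_le_one₀ (abs_sphereRatio_le _) (div_nonneg (abs_nonneg _) hs)
        (div_le_one_of_le₀ hts hs)
    rw [← mul_assoc, abs_mul, abs_exp]
    refine mul_le_mul h1 (exp_le_exp.2 ?_) (exp_pos _).le zero_le_one
    refine (le_abs_self _).trans ?_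
    rw [abs_mul]
    exact mul_le_mul_of_nonneg_left hts (abs_nonneg r)

/-- The normalisation of the weights in `meanDrift_div_le`: the mean of the first coordinate of
`r e₁ + Z` is `r`. -/
theorem integral_norm_mul_sphereMGFDeriv (r : ℝ) :
    ∫ y, ‖y‖ * sphereMGFDeriv n (r * ‖y‖) ∂(stdGaussian (EuclideanSpace ℝ (Fin n))) =
      r * exp (r ^ 2 / 2) := by
  have h := integral_norm_mul_coord (n := n) (φ := fun _ => 1)
    (f := fun t => t * exp (r * t)) measurable_const (by fun_prop) (C := 1) (c := 1 + |r|) ?_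
  · have h2 := integral_const_add_stdGaussian (r • firstVec n) (f := fun y => y 0) (by fun_prop)
    have e1 : ∀ y : EuclideanSpace ℝ (Fin n),
        exp (⟪r • firstVec n, y⟫ - ‖r • firstVec n‖ ^ 2 / 2) * y 0 =
        exp (-(r ^ 2 / 2)) * (1 * (y 0 * exp (r * y 0))) := by
      intro y
      rw [real_inner_smul_left, real_inner_comm, inner_firstVec, norm_smul,
        norm_firstVec, mul_one, norm_eq_abs, sq_abs, sub_eq_neg_add, exp_add]
      ring
    have e2 : ∀ y : EuclideanSpace ℝ (Fin n), ∫ x, ‖y‖ * x * exp (r * (‖y‖ * x)) ∂(coordLaw n) =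
        ‖y‖ * sphereMGFDeriv n (r * ‖y‖) := by
      intro y
      rw [sphereMGFDeriv, ← integral_const_mul]
      congr 1; ext x; ring_nf
    have e3 : ∫ z, (r • firstVec n + z) 0 ∂(stdGaussian (EuclideanSpace ℝ (Fin n))) = r := by
      have : ∀ z : EuclideanSpace ℝ (Fin n), (r • firstVec n + z) 0 = r + ⟪firstVec n, z⟫ := by
        intro z; rw [real_inner_comm, inner_firstVec]; simp [firstVec]
      have hi : Integrable (fun z => ⟪firstVec n, z⟫) (stdGaussian (EuclideanSpace ℝ (Fin n))) :=
        IsGaussian.integrable_id.const_inner (𝕜 := ℝ) (firstVec n)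
      simp_rw [this]
      rw [integral_add (integrable_const _) hi, integral_inner_stdGaussian]
      simp
    simp_rw [e1] at h2
    rw [integral_const_mul, h, e3] at h2
    simp_rw [e2, one_mul] at h2
    have h3 : exp (r ^ 2 / 2) * exp (-(r ^ 2 / 2)) = 1 := by rw [← exp_add]; simp
    rw [← one_mul (∫ y, _ ∂_), ← h3, mul_assoc, ← h2, mul_comm]
  · intro s t hts
    have hs : 0 ≤ s := (abs_nonneg t).trans hts
    rw [one_mul, one_mul, abs_mul, abs_exp, add_mul, one_mul, exp_add]
    refine mul_le_mul (hts.trans ?_) (exp_le_exp.2 ?_) (exp_pos _).le (exp_pos _).le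
    · linarith [add_one_le_exp s]
    · refine (le_abs_self _).trans ?_
      rw [abs_mul]
      exact mul_le_mul_of_nonneg_left hts (abs_nonneg r)

theorem sphereMGFDeriv_le (r : ℝ) (y : EuclideanSpace ℝ (Fin n)) :
    |sphereMGFDeriv n (r * ‖y‖)| ≤ exp (|r| * ‖y‖) := by
  refine (abs_sphereMGFDeriv_le _).trans ((sphereMGF_le _).trans_eq ?_)
  rw [abs_mul, abs_norm]

theorem integrable_ratio_mul_sphereMGFDeriv (R r : ℝ) :
    Integrable (fun y => sphereRatio n (R * ‖y‖) * sphereMGFDeriv n (r * ‖y‖))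
      (stdGaussian (EuclideanSpace ℝ (Fin n))) := by
  refine integrable_stdGaussian_of_le (C := 1) (c := |r|)
    ((continuous_sphereRatio.comp (by fun_prop)).mul
      (continuous_sphereMGFDeriv.comp (by fun_prop))).measurable fun y => ?_
  rw [abs_mul]
  exact mul_le_mul (abs_sphereRatio_le _) (sphereMGFDeriv_le r y) (abs_nonneg _) zero_le_one

theorem integrable_norm_mul_sphereMGFDeriv (r : ℝ) :
    Integrable (fun y => ‖y‖ * sphereMGFDeriv n (r * ‖y‖))
      (stdGaussian (EuclideanSpace ℝ (Fin n))) := by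
  refine integrable_stdGaussian_of_le (C := 1) (c := 1 + |r|)
    (continuous_norm.mul (continuous_sphereMGFDeriv.comp (by fun_prop))).measurable fun y => ?_
  rw [abs_mul, abs_norm, one_mul, add_mul, one_mul, exp_add]
  exact mul_le_mul (by linarith [add_one_le_exp ‖y‖]) (sphereMGFDeriv_le r y) (abs_nonneg _)
    (exp_pos _).le

/-- The slope `meanDrift n R r / r` is an average of the decreasing function `s ↦ h (R s) / s` with
respect to weights with monotone likelihood ratio in `r`. -/
theorem meanDrift_div_le {R r r' : ℝ} (hR : 0 < R) (hr : 0 < r) (hrr : r ≤ r') :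
    meanDrift n R r' / r' ≤ meanDrift n R r / r := by
  have hr' := hr.trans_le hrr
  have e : ∀ r : ℝ, (fun y : EuclideanSpace ℝ (Fin n) =>
      sphereRatio n (R * ‖y‖) / ‖y‖ * (‖y‖ * sphereMGFDeriv n (r * ‖y‖))) =
      fun y => sphereRatio n (R * ‖y‖) * sphereMGFDeriv n (r * ‖y‖) := by
    intro r
    funext y
    rcases eq_or_ne ‖y‖ 0 with h0 | h0
    · simp [h0, sphereRatio_zero]
    · field_simp
  have h := integral_mul_integral_le_of_det (μ := stdGaussian (EuclideanSpace ℝ (Fin n)))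
    (f₁ := fun y => sphereRatio n (R * ‖y‖) / ‖y‖) (f₂ := fun _ => 1)
    (g₁ := fun y => ‖y‖ * sphereMGFDeriv n (r * ‖y‖))
    (g₂ := fun y => ‖y‖ * sphereMGFDeriv n (r' * ‖y‖))
    (by rw [e]; exact integrable_ratio_mul_sphereMGFDeriv R r)
    (by rw [e]; exact integrable_ratio_mul_sphereMGFDeriv R r')
    (by simpa using integrable_norm_mul_sphereMGFDeriv r)
    (by simpa using integrable_norm_mul_sphereMGFDeriv r') ?_
  · rw [e, e] at h
    simp only [one_mul, integral_norm_mul_sphereMGFDeriv] at h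
    rw [div_le_div_iff₀ hr' hr, meanDrift_eq_integral hR, meanDrift_eq_integral hR]
    have h0 := mul_le_mul_of_nonneg_left h
      (mul_pos (exp_pos (-(r ^ 2 / 2))) (exp_pos (-(r' ^ 2 / 2)))).le
    have h1 : exp (-(r ^ 2 / 2)) * exp (r ^ 2 / 2) = 1 := by rw [← exp_add]; simp
    have h2 : exp (-(r' ^ 2 / 2)) * exp (r' ^ 2 / 2) = 1 := by rw [← exp_add]; simp
    linear_combination h0 - (exp (-(r' ^ 2 / 2)) * r * ∫ y, sphereRatio n (R * ‖y‖) *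
      sphereMGFDeriv n (r' * ‖y‖) ∂(stdGaussian (EuclideanSpace ℝ (Fin n)))) * h1 +
      (exp (-(r ^ 2 / 2)) * r' * ∫ y, sphereRatio n (R * ‖y‖) *
      sphereMGFDeriv n (r * ‖y‖) ∂(stdGaussian (EuclideanSpace ℝ (Fin n)))) * h2
  · have key : ∀ x y : EuclideanSpace ℝ (Fin n), ‖x‖ ≤ ‖y‖ →
        0 ≤ (sphereRatio n (R * ‖x‖) / ‖x‖ * 1 - sphereRatio n (R * ‖y‖) / ‖y‖ * 1) *
          (‖x‖ * sphereMGFDeriv n (r * ‖x‖) * (‖y‖ * sphereMGFDeriv n (r' * ‖y‖)) -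
            ‖y‖ * sphereMGFDeriv n (r * ‖y‖) * (‖x‖ * sphereMGFDeriv n (r' * ‖x‖))) := by
      intro x y hxy
      rcases (norm_nonneg x).eq_or_lt with h0 | h0
      · simp [← h0]
      · have hy := h0.trans_le hxy
        have h1 := sphereRatio_div_le (n := n) (mul_pos hR h0) (mul_le_mul_of_nonneg_left hxy hR.le)
        rw [mul_comm R ‖x‖, mul_comm R ‖y‖, ← div_div, ← div_div,
          div_le_div_iff_of_pos_right hR, mul_comm ‖x‖ R, mul_comm ‖y‖ R] at h1
        have h2 := sphereMGFDeriv_mul_le (n := n) hr.le hrr h0.le hxy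
        refine mul_nonneg (by linarith) ?_
        have h3 := mul_le_mul_of_nonneg_left h2 (mul_pos h0 hy).le
        linarith
    intro x y
    rcases le_total ‖x‖ ‖y‖ with hxy | hxy
    · exact key x y hxy
    · have := key y x hxy
      linarith

/-- Along a ray, `infoDensity` first decreases and then increases. -/
theorem infoDensity_le_max {R r : ℝ} (hr : 0 ≤ r) (hrR : r ≤ R) :
    infoDensity (sphereInput n R) (r • firstVec n) ≤
      max (infoDensity (sphereInput n R) 0) (infoDensity (sphereInput n R) (R • firstVec n)) := by
  set g := fun r : ℝ => infoDensity (sphereInput n R) (r • firstVec n) with hg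
  have hd := fun r => hasDerivAt_infoDensity (n := n) R r
  have hgc : Continuous g := continuous_iff_continuousAt.2 fun r => (hd r).continuousAt
  rw [le_max_iff]
  by_contra! hcon
  obtain ⟨h0, hR⟩ := hcon
  have hg0 : g 0 < g r := by simpa [hg] using h0
  have hr0 : 0 < r := hr.lt_of_ne (by rintro rfl; exact lt_irrefl _ hg0)
  have hrR' : r < R := hrR.lt_of_ne (by rintro rfl; exact lt_irrefl _ hR)
  obtain ⟨ρ, hρ, hρe⟩ := exists_hasDerivAt_eq_slope g _ hr0 hgc.continuousOn fun r _ => hd r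
  obtain ⟨τ, hτ, hτe⟩ := exists_hasDerivAt_eq_slope g _ hrR' hgc.continuousOn fun r _ => hd r
  have h1 : 0 < ρ - R * meanDrift n R ρ := by
    rw [hρe]; exact div_pos (by linarith) (by linarith)
  have h2 : τ - R * meanDrift n R τ < 0 := by
    rw [hτe]; exact div_neg_of_neg_of_pos (by linarith) (by linarith)
  have hR0 := hr0.trans hrR'
  have hτ0 := hr0.trans hτ.1
  have h3 := meanDrift_div_le (n := n) hR0 hρ.1 (hρ.2.trans hτ.1).le
  have h4 : R * (meanDrift n R ρ / ρ) < 1 := by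
    rw [← mul_div_assoc, div_lt_one hρ.1]; linarith
  have h5 : 1 < R * (meanDrift n R τ / τ) := by
    rw [← mul_div_assoc, one_lt_div hτ0]; linarith
  have h6 := mul_le_mul_of_nonneg_left h3 hR0.le
  linarith

/-- Since `infoDensity` is largest at the centre or on the sphere, optimality only has to be tested
at the centre. -/
theorem isOptimalInput_sphereInput_iff {R : ℝ} (hR : 0 < R) :
    IsOptimalInput n R (sphereInput n R) ↔
      ∫ u in (0 : ℝ)..1, meanDrift n R (u * R) ≤ 1 / 2 := by
  have hadm := sphereInput_admissible (n := n) hR.le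
  have hreal := realInformation_sphereInput (n := n) hR.le
  have hsub := infoDensity_sub_eq (n := n) R
  have hR2 : 0 < R ^ 2 := by positivity
  constructor
  · intro h
    have h0 := h.infoDensity_le (x := 0) (by simpa using hR.le)
    rw [hreal] at h0
    have : 0 ≤ R ^ 2 * (1 / 2 - ∫ u in (0 : ℝ)..1, meanDrift n R (u * R)) := by
      rw [← hsub]; linarith
    linarith [nonneg_of_mul_nonneg_right this hR2]
  · intro h
    have h0 : infoDensity (sphereInput n R) 0 ≤ infoDensity (sphereInput n R) (R • firstVec n) := by
      have : 0 ≤ R ^ 2 * (1 / 2 - ∫ u in (0 : ℝ)..1, meanDrift n R (u * R)) :=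
        mul_nonneg hR2.le (by linarith)
      linarith
    refine hadm.isOptimalInput_of_infoDensity_le fun x hx => ?_
    rw [hreal, infoDensity_sphereInput_congr R (y := ‖x‖ • firstVec n)
      (by rw [norm_smul, norm_firstVec, norm_norm, mul_one])]
    exact (infoDensity_le_max (norm_nonneg x) hx).trans_eq (max_eq_right h0)

end SphereInfo

/-! ### The sphere functional -/

section Functional

/-- The difference of Gaussian tails as a mixture of Gaussian densities. -/
theorem ofReal_gaussianQ_sub {R : ℝ} (hR : 0 < R) (w : ℝ) :
    ENNReal.ofReal ((gaussianQ (w - R) - gaussianQ w) / R) =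
      ∫⁻ u in Ioc (0 : ℝ) 1, gaussianPDF (u * R) 1 w := by
  have hcont : Continuous (gaussianPDFReal 0 1) := by
    unfold gaussianPDFReal
    fun_prop
  have h1 : gaussianQ (w - R) - gaussianQ w = ∫ t in (w - R)..w, gaussianPDFReal 0 1 t := by
    have hsplit : Ioi (w - R) = Ioc (w - R) w ∪ Ioi w := (Ioc_union_Ioi_eq_Ioi (by linarith)).symm
    have hdisj : Disjoint (Ioc (w - R) w) (Ioi w) :=
      Set.disjoint_left.2 fun x hx hx' => not_lt.2 hx.2 hx'
    rw [gaussianQ, gaussianQ, hsplit, measureReal_union hdisj measurableSet_Ioi,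
      add_sub_cancel_right, measureReal_def, gaussianReal_apply_eq_integral 0 one_ne_zero,
      ENNReal.toReal_ofReal (integral_nonneg fun x => gaussianPDFReal_nonneg _ _ _),
      intervalIntegral.integral_of_le (by linarith)]
  have h2 : ∫ u in (0 : ℝ)..1, gaussianPDFReal 0 1 (w - R * u) =
      (gaussianQ (w - R) - gaussianQ w) / R := by
    rw [h1, intervalIntegral.integral_comp_sub_mul _ hR.ne']
    simp
    ring
  have h3 : ∀ u : ℝ, gaussianPDFReal 0 1 (w - R * u) = gaussianPDFReal (u * R) 1 w := by
    intro u
    simp [gaussianPDFReal, mul_comm R u]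
  rw [← h2, intervalIntegral.integral_of_le zero_le_one, ofReal_integral_eq_lintegral_ofReal]
  · simp_rw [h3, gaussianPDF]
  · have hc : Continuous fun u => gaussianPDFReal 0 1 (w - R * u) := by fun_prop
    exact hc.integrableOn_Icc.mono_set Ioc_subset_Icc_self
  · exact Eventually.of_forall fun u => gaussianPDFReal_nonneg _ _ _

theorem firstCoordLaw_apply {R : ℝ} (hR : 0 < R) {s : Set ℝ} (hs : MeasurableSet s) :
    firstCoordLaw R s = ∫⁻ u in Ioc (0 : ℝ) 1, gaussianReal (u * R) 1 s := by
  rw [firstCoordLaw, withDensity_apply _ hs]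
  simp_rw [ofReal_gaussianQ_sub hR]
  rw [lintegral_lintegral_swap]
  · refine lintegral_congr fun u => ?_
    rw [gaussianReal_apply _ one_ne_zero]
  · exact (measurable_uncurry_gaussianPDF.comp
      (by fun_prop : Measurable fun p : ℝ × ℝ => (p.2 * R, (1 : NNReal), p.1))).aemeasurable

theorem isProbabilityMeasure_firstCoordLaw {R : ℝ} (hR : 0 < R) :
    IsProbabilityMeasure (firstCoordLaw R) := by
  constructor
  rw [firstCoordLaw_apply hR .univ]
  simp

variable {n : ℕ} [NeZero n]

/-- `W` is distributed as `U R e₁ + Z` with `U` uniform on `(0, 1]` and `Z` standard Gaussian. -/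
theorem vectorLaw_eq_map {R : ℝ} (hR : 0 < R) :
    vectorLaw n R = ((volume.restrict (Ioc (0 : ℝ) 1)).prod
      (stdGaussian (EuclideanSpace ℝ (Fin n)))).map
        (fun p => (p.1 * R) • firstVec n + p.2) := by
  have := isProbabilityMeasure_firstCoordLaw hR
  have hσ : ∀ i : Fin n, SigmaFinite (if i = 0 then firstCoordLaw R else gaussianReal 0 1) := by
    intro i
    split_ifs <;> infer_instance
  set κ := Measure.pi fun _ : Fin n => gaussianReal 0 1 with hκ
  set ν := volume.restrict (Ioc (0 : ℝ) 1) with hν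
  set f : ℝ × (Fin n → ℝ) → (Fin n → ℝ) := fun p i => (if i = 0 then p.1 * R else 0) + p.2 i with hf
  have hfm : Measurable f := by
    refine measurable_pi_lambda _ fun i => ?_
    by_cases hi : i = 0
    · simp only [hf, hi, if_true]; fun_prop
    · simp only [hf, hi, if_false]; fun_prop
  have h1 : Measure.pi (fun i : Fin n => if i = 0 then firstCoordLaw R else gaussianReal 0 1) =
      (ν.prod κ).map f := by
    refine Measure.pi_eq fun s hs => ?_
    rw [Measure.map_apply hfm (MeasurableSet.univ_pi hs), Measure.prod_apply
      (hfm (MeasurableSet.univ_pi hs))]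
    have h2 : ∀ u : ℝ, κ (Prod.mk u ⁻¹' (f ⁻¹' univ.pi s)) =
        gaussianReal (u * R) 1 (s 0) * ∏ i ∈ Finset.univ.erase 0, gaussianReal 0 1 (s i) := by
      intro u
      have h3 : Prod.mk u ⁻¹' (f ⁻¹' univ.pi s) =
          univ.pi fun i => (fun x => (if i = 0 then u * R else 0) + x) ⁻¹' s i := by
        ext x; simp [hf]
      rw [h3, hκ, Measure.pi_pi, ← Finset.mul_prod_erase _ _ (Finset.mem_univ 0)]
      congr 1
      · rw [if_pos rfl, ← Measure.map_apply (by fun_prop) (hs 0),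
          gaussianReal_map_const_add, zero_add]
      · refine Finset.prod_congr rfl fun i hi => ?_
        simp [Finset.ne_of_mem_erase hi]
    simp_rw [h2]
    rw [lintegral_mul_const'' _ ?_, ← Finset.mul_prod_erase _ _ (Finset.mem_univ 0), if_pos rfl,
      firstCoordLaw_apply hR (hs 0)]
    · congr 1
      refine Finset.prod_congr rfl fun i hi => ?_
      rw [if_neg (Finset.ne_of_mem_erase hi)]
    · exact (((Measure.measurable_coe (hs 0)).comp measurable_gaussianReal).comp
        (by fun_prop : Measurable fun u : ℝ => (u * R, (1 : NNReal)))).aemeasurable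
  rw [vectorLaw, h1, ← map_pi_eq_stdGaussian, Measure.map_map (by fun_prop) hfm]
  have h4 : ν.prod (κ.map (WithLp.toLp 2)) = (ν.prod κ).map (Prod.map id (WithLp.toLp 2)) := by
    rw [← Measure.map_prod_map _ _ measurable_id (by fun_prop), Measure.map_id]
  rw [h4, Measure.map_map (by fun_prop) (by fun_prop)]
  congr 1
  funext p
  ext i
  by_cases hi : i = 0
  · subst hi; simp [hf, firstVec]
  · simp [hf, firstVec, hi]

theorem sphereFunctional_eq {R : ℝ} (hR : 0 < R) :
    sphereFunctional n R = ∫ u in (0 : ℝ)..1, meanDrift n R (u * R) := by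
  have h1 : ∀ w : EuclideanSpace ℝ (Fin n),
      w 0 / ‖w‖ * besselRatio ((n : ℝ) / 2) (R * ‖w‖) = tiltedMean (R • w) := by
    intro w
    rw [tiltedMean_smul hR, besselRatio_eq_sphereRatio (by positivity)]
  have hc : Continuous fun w : EuclideanSpace ℝ (Fin n) => tiltedMean (R • w) :=
    continuous_tiltedMean.comp (by fun_prop)
  simp_rw [sphereFunctional, h1]
  rw [vectorLaw_eq_map hR, integral_map (by fun_prop) hc.aestronglyMeasurable, integral_prod,
    intervalIntegral.integral_of_le zero_le_one]
  · rfl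
  · refine Integrable.of_bound (C := 1) ?_ (Eventually.of_forall fun p => abs_tiltedMean_le _)
    exact (hc.comp (by fun_prop)).aestronglyMeasurable

theorem integral_sphereMGF_stdGaussian (r : ℝ) :
    ∫ y, sphereMGF n (r * ‖y‖) ∂(stdGaussian (EuclideanSpace ℝ (Fin n))) = exp (r ^ 2 / 2) := by
  have h := integral_norm_mul_coord (n := n) (φ := fun _ => 1)
    (f := fun t => exp (r * t)) measurable_const (by fun_prop) (C := 1) (c := |r|) ?_
  · have h2 := integral_const_add_stdGaussian (r • firstVec n) (f := fun _ => 1) (by fun_prop)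
    have e1 : ∀ y : EuclideanSpace ℝ (Fin n),
        exp (⟪r • firstVec n, y⟫ - ‖r • firstVec n‖ ^ 2 / 2) * 1 =
        exp (-(r ^ 2 / 2)) * (1 * exp (r * y 0)) := by
      intro y
      rw [real_inner_smul_left, real_inner_comm, inner_firstVec, norm_smul,
        norm_firstVec, mul_one, mul_one, norm_eq_abs, sq_abs, sub_eq_neg_add, exp_add]
      ring
    have e2 : ∀ y : EuclideanSpace ℝ (Fin n), ∫ x, exp (r * (‖y‖ * x)) ∂(coordLaw n) =
        sphereMGF n (r * ‖y‖) := by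
      intro y
      rw [sphereMGF]
      congr 1; ext x; ring_nf
    simp_rw [e1] at h2
    rw [integral_const_mul, h] at h2
    simp_rw [e2, one_mul] at h2
    simp only [integral_const, probReal_univ, one_smul] at h2
    have h3 : exp (r ^ 2 / 2) * exp (-(r ^ 2 / 2)) = 1 := by rw [← exp_add]; simp
    rw [← one_mul (∫ y, _ ∂_), ← h3, mul_assoc, ← h2, mul_one]
  · intro s t hts
    rw [one_mul, one_mul, abs_exp]
    refine exp_le_exp.2 ((le_abs_self _).trans ?_)
    rw [abs_mul]
    exact mul_le_mul_of_nonneg_left hts (abs_nonneg r)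

theorem integrable_bdd_mul_sphereMGF {φ : ℝ → ℝ} (hφ : Continuous φ) (hb : ∀ s, |φ s| ≤ 1) (r : ℝ) :
    Integrable (fun y => φ ‖y‖ * sphereMGF n (r * ‖y‖))
      (stdGaussian (EuclideanSpace ℝ (Fin n))) := by
  refine integrable_stdGaussian_of_le (C := 1) (c := |r|)
    ((hφ.comp continuous_norm).mul (continuous_sphereMGF.comp (by fun_prop))).measurable fun y => ?_
  rw [abs_mul, abs_of_pos (sphereMGF_pos _)]
  refine mul_le_mul (hb _) ((sphereMGF_le _).trans_eq ?_) (sphereMGF_pos _).le zero_le_one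
  rw [abs_mul, abs_norm]

/-- The noncentral chi laws increase stochastically with the noncentrality parameter. -/
theorem integral_mul_sphereMGF_mono {φ : ℝ → ℝ} (hφ : Continuous φ) (hb : ∀ s, |φ s| ≤ 1)
    (hmono : MonotoneOn φ (Ici 0)) {r r' : ℝ} (hr : 0 ≤ r) (hrr : r ≤ r') :
    exp (-(r ^ 2 / 2)) * ∫ y, φ ‖y‖ * sphereMGF n (r * ‖y‖)
        ∂(stdGaussian (EuclideanSpace ℝ (Fin n))) ≤
      exp (-(r' ^ 2 / 2)) * ∫ y, φ ‖y‖ * sphereMGF n (r' * ‖y‖)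
        ∂(stdGaussian (EuclideanSpace ℝ (Fin n))) := by
  have h1 : ∀ r, Integrable (fun y => 1 * sphereMGF n (r * ‖y‖))
      (stdGaussian (EuclideanSpace ℝ (Fin n))) := fun r =>
    integrable_bdd_mul_sphereMGF (φ := fun _ => 1) continuous_const (by simp) r
  have h := integral_mul_integral_le_of_det (μ := stdGaussian (EuclideanSpace ℝ (Fin n)))
    (f₁ := fun y => φ ‖y‖) (f₂ := fun _ => 1) (g₁ := fun y => sphereMGF n (r' * ‖y‖))
    (g₂ := fun y => sphereMGF n (r * ‖y‖)) (integrable_bdd_mul_sphereMGF hφ hb r')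
    (integrable_bdd_mul_sphereMGF hφ hb r) (h1 _) (h1 _) ?_
  · simp only [one_mul, integral_sphereMGF_stdGaussian] at h
    have h0 := mul_le_mul_of_nonneg_left h
      (mul_pos (exp_pos (-(r ^ 2 / 2))) (exp_pos (-(r' ^ 2 / 2)))).le
    have h1 : exp (-(r ^ 2 / 2)) * exp (r ^ 2 / 2) = 1 := by rw [← exp_add]; simp
    have h2 : exp (-(r' ^ 2 / 2)) * exp (r' ^ 2 / 2) = 1 := by rw [← exp_add]; simp
    linear_combination h0 - (exp (-(r ^ 2 / 2)) * ∫ y, φ ‖y‖ * sphereMGF n (r * ‖y‖)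
        ∂(stdGaussian (EuclideanSpace ℝ (Fin n)))) * h2 +
      (exp (-(r' ^ 2 / 2)) * ∫ y, φ ‖y‖ * sphereMGF n (r' * ‖y‖)
        ∂(stdGaussian (EuclideanSpace ℝ (Fin n)))) * h1
  · have key : ∀ x y : EuclideanSpace ℝ (Fin n), ‖x‖ ≤ ‖y‖ →
        0 ≤ (φ ‖x‖ * 1 - φ ‖y‖ * 1) * (sphereMGF n (r' * ‖x‖) * sphereMGF n (r * ‖y‖) -
          sphereMGF n (r' * ‖y‖) * sphereMGF n (r * ‖x‖)) := by
      intro x y hxy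
      have h1 := hmono (norm_nonneg x) (norm_nonneg y) hxy
      have h2 := sphereMGF_mul_le (n := n) hr hrr (norm_nonneg x) hxy
      exact mul_nonneg_of_nonpos_of_nonpos (by linarith) (by linarith)
    intro x y
    rcases le_total ‖x‖ ‖y‖ with hxy | hxy
    · exact key x y hxy
    · have := key y x hxy
      linarith

theorem sphereRatio_mul_monotoneOn {R r : ℝ} (hR : 0 ≤ R) (hr : 0 ≤ r) :
    MonotoneOn (fun s => sphereRatio n (R * s) * sphereRatio n (r * s)) (Ici 0) := by
  intro s hs t _ hst
  have hm := (sphereRatio_strictMono (n := n)).monotone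
  have hs' : 0 ≤ s := hs
  exact mul_le_mul (hm (mul_le_mul_of_nonneg_left hst hR)) (hm (mul_le_mul_of_nonneg_left hst hr))
    (sphereRatio_nonneg (by positivity)) (sphereRatio_nonneg (mul_nonneg hR (hs'.trans hst)))

theorem meanDrift_eq_integral_mul {R r : ℝ} (hR : 0 < R) :
    meanDrift n R r = exp (-(r ^ 2 / 2)) *
      ∫ y, (sphereRatio n (R * ‖y‖) * sphereRatio n (r * ‖y‖)) * sphereMGF n (r * ‖y‖)
        ∂(stdGaussian (EuclideanSpace ℝ (Fin n))) := by
  rw [meanDrift_eq_integral hR]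
  congr 2
  ext y
  rw [mul_assoc, sphereRatio, sphereRatio, div_mul_cancel₀ _ (sphereMGF_pos _).ne']

theorem meanDrift_lt {R R' u : ℝ} (hR : 0 < R) (hRR : R < R') (hu : 0 < u) :
    meanDrift n R (u * R) < meanDrift n R' (u * R') := by
  have hR' := hR.trans hRR
  have hle : u * R ≤ u * R' := mul_le_mul_of_nonneg_left hRR.le hu.le
  have hcont : ∀ a b : ℝ, Continuous fun s => sphereRatio n (a * s) * sphereRatio n (b * s) := by
    intro a b
    exact (continuous_sphereRatio.comp (by fun_prop)).mul
      (continuous_sphereRatio.comp (by fun_prop))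
  have hbdd : ∀ a b s : ℝ, |sphereRatio n (a * s) * sphereRatio n (b * s)| ≤ 1 := by
    intro a b s
    rw [abs_mul]
    exact mul_le_one₀ (abs_sphereRatio_le _) (abs_nonneg _) (abs_sphereRatio_le _)
  rw [meanDrift_eq_integral_mul hR, meanDrift_eq_integral_mul hR']
  refine (integral_mul_sphereMGF_mono (hcont _ _) (hbdd _ _)
    (sphereRatio_mul_monotoneOn hR.le (by positivity)) (by positivity) hle).trans_lt ?_
  refine mul_lt_mul_of_pos_left ?_ (exp_pos _)
  have hi := integrable_bdd_mul_sphereMGF (n := n) (hcont R (u * R)) (hbdd R (u * R)) (u * R')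
  have hi' := integrable_bdd_mul_sphereMGF (n := n) (hcont R' (u * R')) (hbdd R' (u * R')) (u * R')
  rw [← sub_pos, ← integral_sub hi' hi]
  have hm := sphereRatio_strictMono (n := n)
  have hpt : ∀ y : EuclideanSpace ℝ (Fin n), y ≠ 0 →
      0 < sphereRatio n (R' * ‖y‖) * sphereRatio n (u * R' * ‖y‖) * sphereMGF n (u * R' * ‖y‖) -
        sphereRatio n (R * ‖y‖) * sphereRatio n (u * R * ‖y‖) * sphereMGF n (u * R' * ‖y‖) := by
    intro y hy
    have hy0 : 0 < ‖y‖ := norm_pos_iff.2 hy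
    rw [← sub_mul]
    refine mul_pos (sub_pos.2 ?_) (sphereMGF_pos _)
    refine mul_lt_mul'' (hm (mul_lt_mul_of_pos_right hRR hy0)) (hm ?_)
      (sphereRatio_nonneg (by positivity)) (sphereRatio_nonneg (by positivity))
    exact mul_lt_mul_of_pos_right (mul_lt_mul_of_pos_left hRR hu) hy0
  refine (integral_pos_iff_support_of_nonneg ?_ (hi'.sub hi)).2 ?_
  rotate_left
  · refine pos_iff_ne_zero.2 fun h0 => stdGaussian_compl_zero_ne (n := n) ?_
    exact measure_mono_null (fun y hy => (hpt y hy).ne') h0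
  · intro y
    rcases eq_or_ne y 0 with rfl | hy
    · simp [sphereRatio_zero]
    · exact (hpt y hy).le

theorem strictMonoOn_integral_meanDrift :
    StrictMonoOn (fun R => ∫ u in (0 : ℝ)..1, meanDrift n R (u * R)) (Ioi 0) := by
  intro R hR R' hR' hRR
  have hc : ∀ R, Continuous fun u => meanDrift n R (u * R) := fun R =>
    (continuous_meanDrift.uncurry_left R).comp (by fun_prop)
  refine intervalIntegral.integral_lt_integral_of_continuousOn_of_le_of_exists_lt zero_lt_one
    (hc R).continuousOn (hc R').continuousOn (fun u hu => (meanDrift_lt hR hRR hu.1).le)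
    ⟨1, by simp, meanDrift_lt hR hRR one_pos⟩

theorem continuous_integral_meanDrift :
    Continuous (fun R => ∫ u in (0 : ℝ)..1, meanDrift n R (u * R)) := by
  refine intervalIntegral.continuous_parametric_intervalIntegral_of_continuous' ?_ 0 1
  exact continuous_meanDrift.comp (f := fun p : ℝ × ℝ => (p.1, p.2 * p.1)) (by fun_prop)

theorem integral_meanDrift_zero : ∫ u in (0 : ℝ)..1, meanDrift n 0 (u * 0) = 0 := by
  simp [meanDrift, tiltedMean_eq]

theorem tendsto_tiltedMean {u : ℝ} (hu : 0 < u) (z : EuclideanSpace ℝ (Fin n)) :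
    Tendsto (fun R : ℝ => tiltedMean (R • ((u * R) • firstVec n + z))) atTop (𝓝 1) := by
  -- After division by `R`, the vector `u R e₁ + z` converges to `u e₁`.
  have hlim : Tendsto (fun R : ℝ => u • firstVec n + R⁻¹ • z) atTop (𝓝 (u • firstVec n)) := by
    have h : Tendsto (fun R : ℝ => R⁻¹ • z) atTop (𝓝 ((0 : ℝ) • z)) :=
      tendsto_inv_atTop_zero.smul_const z
    simpa using h.const_add (u • firstVec n)
  have hn : Tendsto (fun R : ℝ => ‖u • firstVec n + R⁻¹ • z‖) atTop (𝓝 u) := by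
    have := hlim.norm
    rwa [norm_smul, norm_firstVec, mul_one, norm_of_nonneg hu.le] at this
  have h0 : Tendsto (fun R : ℝ => (u • firstVec n + R⁻¹ • z) 0) atTop (𝓝 u) := by
    have h : Continuous fun x : EuclideanSpace ℝ (Fin n) => x 0 := by fun_prop
    have h1 := (h.tendsto _).comp hlim
    have h2 : (u • firstVec n) 0 = u := by simp [firstVec]
    rwa [h2] at h1
  have hsq : Tendsto (fun R : ℝ => R ^ 2 * ‖u • firstVec n + R⁻¹ • z‖) atTop atTop :=
    (tendsto_pow_atTop two_ne_zero).atTop_mul_pos hu hn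
  have hprod := (h0.div hn hu.ne').mul (tendsto_sphereRatio (n := n).comp hsq)
  rw [div_self hu.ne', one_mul] at hprod
  refine hprod.congr' ?_
  filter_upwards [eventually_gt_atTop 0] with R hR
  have e : R • ((u * R) • firstVec n + z) = (R ^ 2) • (u • firstVec n + R⁻¹ • z) := by
    rw [smul_add, smul_add, smul_smul, smul_smul, smul_smul]
    congr 2
    · ring
    · field_simp
  rw [e, tiltedMean_smul (by positivity)]
  rfl

theorem tendsto_integral_meanDrift :
    Tendsto (fun R => ∫ u in (0 : ℝ)..1, meanDrift n R (u * R)) atTop (𝓝 1) := by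
  have hc : ∀ R, Continuous fun u => meanDrift n R (u * R) := fun R =>
    (continuous_meanDrift.uncurry_left R).comp (by fun_prop)
  have h := intervalIntegral.tendsto_integral_filter_of_dominated_convergence (μ := volume)
    (a := 0) (b := 1) (l := atTop) (F := fun (R u : ℝ) => meanDrift n R (u * R))
    (f := fun _ => (1 : ℝ))
    (fun _ => 1) (Eventually.of_forall fun R => (hc R).aestronglyMeasurable)
    (Eventually.of_forall fun R => Eventually.of_forall fun u _ => abs_meanDrift_le _ _)
    (by simp) ?_
  · simpa using h
  · refine Eventually.of_forall fun u hu => ?_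
    rw [uIoc_of_le zero_le_one] at hu
    have h := tendsto_integral_filter_of_dominated_convergence
      (μ := stdGaussian (EuclideanSpace ℝ (Fin n))) (l := atTop)
      (F := fun (R : ℝ) z => tiltedMean (R • ((u * R) • firstVec n + z))) (f := fun _ => (1 : ℝ))
      (fun _ => 1) (Eventually.of_forall fun R =>
        (continuous_tiltedMean.comp (by fun_prop)).aestronglyMeasurable)
      (Eventually.of_forall fun R => Eventually.of_forall fun z => abs_tiltedMean_le _)
      (integrable_const _) (Eventually.of_forall fun z => tendsto_tiltedMean hu.1 z)
    simp only [integral_const, probReal_univ, one_smul] at h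
    exact h

theorem exists_integral_meanDrift_eq :
    ∃ R : ℝ, 0 < R ∧ ∫ u in (0 : ℝ)..1, meanDrift n R (u * R) = 1 / 2 := by
  obtain ⟨S, hS, hS0⟩ := ((tendsto_integral_meanDrift (n := n)).eventually_const_lt
    (show (1 / 2 : ℝ) < 1 by norm_num)).and (eventually_gt_atTop 0) |>.exists
  obtain ⟨R, hR, hRe⟩ := intermediate_value_Ioo hS0.le
    (continuous_integral_meanDrift (n := n)).continuousOn
    (show (1 / 2 : ℝ) ∈ _ from ⟨by simp only [integral_meanDrift_zero]; norm_num, hS⟩)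
  exact ⟨R, hR.1, hRe⟩

end Functional

theorem isOptimalInput_sphereInput_zero (n : ℕ) [NeZero n] :
    IsOptimalInput n 0 (sphereInput n 0) := by
  refine (sphereInput_admissible le_rfl).isOptimalInput_of_infoDensity_le fun x hx => ?_
  rw [realInformation_sphereInput le_rfl,
    infoDensity_sphereInput_congr 0 (x := x) (y := (0 : ℝ) • firstVec n)]
  simpa using norm_le_zero_iff.1 hx

end SphereInput

theorem mainTheorem2 (n : ℕ) [NeZero n] :
    IsGreatest (SphereInput.optimalRadii n) (SphereInput.maxRadius n) ∧
    (∀ R : ℝ, 0 ≤ R →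
      (SphereInput.IsOptimalInput n R (SphereInput.sphereInput n R) ↔
        R ≤ SphereInput.maxRadius n)) ∧
    0 < SphereInput.maxRadius n ∧
    (∀ R : ℝ, 0 < R →
      (SphereInput.sphereFunctional n R = 1 / 2 ↔ R = SphereInput.maxRadius n)) := by
  obtain ⟨ρ, hρ, hρe⟩ := SphereInput.exists_integral_meanDrift_eq (n := n)
  have hmono := SphereInput.strictMonoOn_integral_meanDrift (n := n)
  have hopt : ∀ R : ℝ, 0 ≤ R →
      (SphereInput.IsOptimalInput n R (SphereInput.sphereInput n R) ↔ R ≤ ρ) := by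
    intro R hR
    rcases hR.eq_or_lt with rfl | hR
    · exact iff_of_true (SphereInput.isOptimalInput_sphereInput_zero n) hρ.le
    · rw [SphereInput.isOptimalInput_sphereInput_iff hR, ← hρe]
      exact hmono.le_iff_le hR hρ
  have hset : SphereInput.optimalRadii n = Set.Icc 0 ρ := by
    ext R
    exact ⟨fun h => ⟨h.1, (hopt R h.1).1 h.2⟩, fun h => ⟨h.1, (hopt R h.1).2 h.2⟩⟩
  have hmax : SphereInput.maxRadius n = ρ := by
    rw [SphereInput.maxRadius, hset, csSup_Icc hρ.le]
  rw [hmax, hset]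
  refine ⟨isGreatest_Icc hρ.le, hopt, hρ, fun R hR => ?_⟩
  rw [SphereInput.sphereFunctional_eq hR, ← hρe]
  exact hmono.injOn.eq_iff hR hρ
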